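/- Work over $\mathbb{C}$. Let $X\subset\mathbb{A}^{18}$ be the $\mathsf{G}_2$ cluster variety, with coordinates $\theta_i,\theta_{i,i+1},A_i,A_{i,i+1}$ ($i\in\mathbb{Z}/4$, unordered double indices) and $\lambda_{13},\lambda_{24}$ (also unordered), defined by the 20 equations $$\begin{aligned} \theta_i\theta_j &= A_{ij}\theta_{ij} + A_{jk}A_kA_{kl}^2A_lA_{li},\\ \theta_{ij}\theta_{jk} &= A_j\theta_j^3 + \lambda_{jl}A_{kl}A_{li}\theta_j^2 + \lambda_{ik}A_{kl}^2A_lA_{li}^2\theta_j + A_kA_{kl}^3A_l^2A_{li}^3A_i,\\ \theta_i\theta_{jk} &= A_{ij}A_j\theta_j^2 + \lambda_{jl}A_{kl}A_{li}A_{ij}\theta_j + \lambda_{ik}A_{kl}^2A_lA_{li}^2A_{ij} + A_kA_{kl}^2A_lA_{li}\theta_k,\\ \theta_i\theta_k &= A_{ij}A_jA_{jk}\theta_j + \lambda_{jl}A_{ij}A_{jk}A_{kl}A_{li} + A_{kl}A_lA_{li}\theta_l,\\ \theta_{ij}\theta_{kl} &= A_jA_{jk}^2A_k\theta_j\theta_k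 + A_{li}A_{jk}(\lambda_{ik}\theta_i\theta_k + \lambda_{jl}\theta_j\theta_l) + A_lA_{li}^2A_i\theta_l\theta_i + A_{ij}A_{jk}^2A_{kl}A_{li}^2(A_iA_jA_kA_l - \lambda_{ik}\lambda_{jl}), \end{aligned}$$ where $(i,j,k,l)$ runs over the dihedral permutations of $(1,2,3,4)$. Given integers $\rho_i,\rho_{i,i+1}$, grade the coordinates by $d(\theta_i)=\rho_i$, $d(\theta_{ij})=\rho_{ij}$, $d(A_i)=\rho_{li}-3\rho_i+\rho_{ij}$, $d(A_{ij})=\rho_i-\rho_{ij}+\rho_j$, $d(\lambda_{ik})=-2\rho_i+\rho_{ij}-\rho_j+\rho_{jk}-2\rho_k+\rho_{kl}-\rho_l+\rho_{li}$; the equations are then homogeneous. Let $\mathbb{C}[y_1,\dots,y_{10}]$ be graded with positive integer weights and let $\phi\colon\mathbb{A}^{10}\to\mathbb{A}^{18}$ be a morphism such that, for each coordinate $v$, the polynomial $\phi^*(v)$ is homogeneous of degree $d(v)$ (so zero if $d(v)<0$), and is a nonzero constant if $d(v)=0$. Suppose that $\widehat Y=\phi^{-1}(X)$ has codimension $6$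 (i.e. is a regular pullback), is not a complete intersection, and is quasismooth: at every point other than the vertex $0$ its Jacobian matrix has rank equal to its codimension. Suppose further that $\widehat Y$ is in $\mathsf{G}_2^{(5)}$ format, i.e. $d(A_{12})=0$ and $d(A_{23}),d(A_{34}),d(A_{41})>0$. Then one of the following holds: 1. $d(A_3)\ge0$ and $d(A_4)\ge0$; 2. $d(A_3)<0\le d(A_4)$ and $d(\lambda_{13})=0$; or, symmetrically under $1\leftrightarrow2$, $3\leftrightarrow4$, $d(A_4)<0\le d(A_3)$ and $d(\lambda_{24})=0$; 3. $d(A_3),d(A_4)<0$ and $d(\lambda_{13})=d(\lambda_{24})=0$. The same holds if the redundant variable $\theta_{12}$ is eliminated, i.e. for $\widehat Y=\phi^{-1}(X)\subset\mathbb{A}^9$ of codimension $5$, where $\phi^*(A_{12})=1$, $\phi^*(\theta_{12})=\phi^*(\theta_1\theta_2-A_{23}A_3A_{34}^2A_4A_{41})$, and $\phi^*(v)$ is as above for the other 16 coordinates $v$. -/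

import Mathlib

/-! Cluster format of type `G₂`: labels `1, 2, 3, 4` are read in `ZMod 4` (so `4 = 0`). -/

namespace G2Format

open MvPolynomial

/-- The 18 coordinates on the ambient space of the `G₂` cluster variety:
`θ i = θ_i`, `θE i = θ_{i,i+1}`, `A i = A_i`, `AE i = A_{i,i+1}` for `i` in `ZMod 4`, and
`lam 1 = λ_{13}`, `lam 0 = λ_{24}`. -/
inductive Var : Type
  | θ (i : ZMod 4)
  | θE (i : ZMod 4)
  | A (i : ZMod 4)
  | AE (i : ZMod 4)
  | lam (p : ZMod 2)
  deriving DecidableEq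

/-- The edge `e` of the 4-cycle with `{e, e + 1} = {i, j}`, for adjacent vertices `i`, `j`. -/
def edge (i j : ZMod 4) : ZMod 4 := if j = i + 1 then i else j

/-- The parity of a vertex, `λ_{ik}` being the parameter `lam (par i)`. -/
def par (i : ZMod 4) : ZMod 2 := (i.val : ZMod 2)

section Relations

variable {R : Type*} [CommRing R] (x : Var → R) (i j k l : ZMod 4)

/-- `θ_i θ_j = A_{ij} θ_{ij} + A_{jk} A_k A_{kl}² A_l A_{li}`. -/
def rel1 : R :=
  x (.θ i) * x (.θ j) -
    (x (.AE (edge i j)) * x (.θE (edge i j)) +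
      x (.AE (edge j k)) * x (.A k) * x (.AE (edge k l)) ^ 2 * x (.A l) * x (.AE (edge l i)))

/-- `θ_{ij} θ_{jk} = A_j θ_j³ + λ_{jl} A_{kl} A_{li} θ_j² + λ_{ik} A_{kl}² A_l A_{li}² θ_j
  + A_k A_{kl}³ A_l² A_{li}³ A_i`. -/
def rel2 : R :=
  x (.θE (edge i j)) * x (.θE (edge j k)) -
    (x (.A j) * x (.θ j) ^ 3 +
      x (.lam (par j)) * x (.AE (edge k l)) * x (.AE (edge l i)) * x (.θ j) ^ 2 +
      x (.lam (par i)) * x (.AE (edge k l)) ^ 2 * x (.A l) * x (.AE (edge l i)) ^ 2 * x (.θ j) +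
      x (.A k) * x (.AE (edge k l)) ^ 3 * x (.A l) ^ 2 * x (.AE (edge l i)) ^ 3 * x (.A i))

/-- `θ_i θ_{jk} = A_{ij} A_j θ_j² + λ_{jl} A_{kl} A_{li} A_{ij} θ_j + λ_{ik} A_{kl}² A_l A_{li}² A_{ij}
  + A_k A_{kl}² A_l A_{li} θ_k`. -/
def rel3 : R :=
  x (.θ i) * x (.θE (edge j k)) -
    (x (.AE (edge i j)) * x (.A j) * x (.θ j) ^ 2 +
      x (.lam (par j)) * x (.AE (edge k l)) * x (.AE (edge l i)) * x (.AE (edge i j)) * x (.θ j) +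
      x (.lam (par i)) * x (.AE (edge k l)) ^ 2 * x (.A l) * x (.AE (edge l i)) ^ 2 *
        x (.AE (edge i j)) +
      x (.A k) * x (.AE (edge k l)) ^ 2 * x (.A l) * x (.AE (edge l i)) * x (.θ k))

/-- `θ_i θ_k = A_{ij} A_j A_{jk} θ_j + λ_{jl} A_{ij} A_{jk} A_{kl} A_{li} + A_{kl} A_l A_{li} θ_l`. -/
def rel4 : R :=
  x (.θ i) * x (.θ k) -
    (x (.AE (edge i j)) * x (.A j) * x (.AE (edge j k)) * x (.θ j) +
      x (.lam (par j)) * x (.AE (edge i j)) * x (.AE (edge j k)) * x (.AE (edge k l)) *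
        x (.AE (edge l i)) +
      x (.AE (edge k l)) * x (.A l) * x (.AE (edge l i)) * x (.θ l))

/-- `θ_{ij} θ_{kl} = A_j A_{jk}² A_k θ_j θ_k + A_{li} A_{jk} (λ_{ik} θ_i θ_k + λ_{jl} θ_j θ_l)
  + A_l A_{li}² A_i θ_l θ_i + A_{ij} A_{jk}² A_{kl} A_{li}² (A_i A_j A_k A_l - λ_{ik} λ_{jl})`. -/
def rel5 : R :=
  x (.θE (edge i j)) * x (.θE (edge k l)) -
    (x (.A j) * x (.AE (edge j k)) ^ 2 * x (.A k) * x (.θ j) * x (.θ k) +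
      x (.AE (edge l i)) * x (.AE (edge j k)) *
        (x (.lam (par i)) * x (.θ i) * x (.θ k) + x (.lam (par j)) * x (.θ j) * x (.θ l)) +
      x (.A l) * x (.AE (edge l i)) ^ 2 * x (.A i) * x (.θ l) * x (.θ i) +
      x (.AE (edge i j)) * x (.AE (edge j k)) ^ 2 * x (.AE (edge k l)) * x (.AE (edge l i)) ^ 2 *
        (x (.A i) * x (.A j) * x (.A k) * x (.A l) - x (.lam (par i)) * x (.lam (par j))))

/-- The 20 relations (with repetitions): all five families, where `(i, j, k, l)` runs over the
dihedral permutations `(i, i + ε, i + 2ε, i + 3ε)`, `ε = ±1`, of `(1, 2, 3, 4)`. -/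
def relations : Set R :=
  {f | ∃ i ε : ZMod 4, (ε = 1 ∨ ε = -1) ∧
    (f = rel1 x i (i + ε) (i + 2 * ε) (i + 3 * ε) ∨
     f = rel2 x i (i + ε) (i + 2 * ε) (i + 3 * ε) ∨
     f = rel3 x i (i + ε) (i + 2 * ε) (i + 3 * ε) ∨
     f = rel4 x i (i + ε) (i + 2 * ε) (i + 3 * ε) ∨
     f = rel5 x i (i + ε) (i + 2 * ε) (i + 3 * ε))}

end Relations

/-- The ideal of the `G₂` cluster variety `X ⊆ 𝔸¹⁸`. -/
noncomputable def clusterIdeal : Ideal (MvPolynomial Var ℂ) :=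
  Ideal.span (relations (X : Var → MvPolynomial Var ℂ))

/-- The ideal of the scheme-theoretic preimage `φ⁻¹(X) ⊆ 𝔸ᵐ`, where the morphism
`φ : 𝔸ᵐ → 𝔸¹⁸` is given by the polynomials `φ v = φ^*(v)`. -/
noncomputable def pullbackIdeal {m : ℕ} (φ : Var → MvPolynomial (Fin m) ℂ) :
    Ideal (MvPolynomial (Fin m) ℂ) :=
  clusterIdeal.map (aeval φ : MvPolynomial Var ℂ →ₐ[ℂ] MvPolynomial (Fin m) ℂ)

/-- The degree of each coordinate for the one-parameter subgroup of the torus `𝕋⁸` with weights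
`ρ i` on `θ_i` and `ρE i` on `θ_{i,i+1}`. -/
def deg (ρ ρE : ZMod 4 → ℤ) : Var → ℤ
  | .θ i => ρ i
  | .θE i => ρE i
  | .A i => ρE (i - 1) - 3 * ρ i + ρE i
  | .AE i => ρ i - ρE i + ρ (i + 1)
  | .lam p => ∑ i : ZMod 4, (ρE i - (if par i = p then 2 else 1) * ρ i)

/-- The closed subscheme of `𝔸ᵐ` cut out by `I` is nonsingular of codimension `c` at the point
`p` (Jacobian criterion): the differentials at `p` of the elements of `I` span a space of
dimension `c`. -/
def IsNonsingularAt {m : ℕ} (I : Ideal (MvPolynomial (Fin m) ℂ)) (c : ℕ) (p : Fin m → ℂ) : Prop :=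
  Module.finrank ℂ (Submodule.span ℂ
    {v : Fin m → ℂ | ∃ f ∈ I, v = fun k => eval p (pderiv k f)}) = c

/-- `V(I) ⊆ 𝔸ᵐ` has codimension `c`. -/
def HasCodim {m : ℕ} (I : Ideal (MvPolynomial (Fin m) ℂ)) (c : ℕ) : Prop :=
  ringKrullDim (MvPolynomial (Fin m) ℂ ⧸ I) + c = m

/-- `V(I) ⊆ 𝔸ᵐ`, of codimension `c`, has at worst an isolated singularity at the vertex `0`. -/
def IsQuasismooth {m : ℕ} (I : Ideal (MvPolynomial (Fin m) ℂ)) (c : ℕ) : Prop :=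
  ∀ p : Fin m → ℂ, p ≠ 0 → (∀ f ∈ I, eval p f = 0) → IsNonsingularAt I c p

/-- `V(I) ⊆ 𝔸ᵐ` is a complete intersection. -/
def IsCompleteIntersection {m : ℕ} (I : Ideal (MvPolynomial (Fin m) ℂ)) : Prop :=
  ∃ (c : ℕ) (f : Fin c → MvPolynomial (Fin m) ℂ), I = Ideal.span (Set.range f) ∧ HasCodim I c

/-- `φ^*(v)` is homogeneous of degree `d(v)` for the grading of `ℂ[y₁, …, yₘ]` by the weights `a`
(so it vanishes if `d(v) < 0` and all weights are positive), and it is nonzero if `d(v) = 0`. -/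
def IsAdmissibleAt {m : ℕ} (ρ ρE : ZMod 4 → ℤ) (a : Fin m → ℤ)
    (φ : Var → MvPolynomial (Fin m) ℂ) (v : Var) : Prop :=
  IsWeightedHomogeneous a (φ v) (deg ρ ρE v) ∧ (deg ρ ρE v = 0 → φ v ≠ 0)

/-- `φ⁻¹(X) ⊆ 𝔸¹⁰` is a regular pullback of the `G₂` cluster variety, is not a complete
intersection, and is the 4-dimensional affine cone over a quasismooth weighted projective
3-fold. -/
structure IsG2Cone (ρ ρE : ZMod 4 → ℤ) (a : Fin 10 → ℤ)
    (φ : Var → MvPolynomial (Fin 10) ℂ) : Prop where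
  weight_pos : ∀ k, 0 < a k
  admissible : ∀ v, IsAdmissibleAt ρ ρE a φ v
  codim : HasCodim (pullbackIdeal φ) 6
  quasismooth : IsQuasismooth (pullbackIdeal φ) 6
  not_ci : ¬ IsCompleteIntersection (pullbackIdeal φ)

/-- Specialise `A_{12} = 1` and eliminate
`θ_{12} = θ_1 θ_2 - A_{23} A_3 A_{34}² A_4 A_{41}`; the given values at these two coordinates are
discarded. -/
noncomputable def eliminate {m : ℕ} (φ : Var → MvPolynomial (Fin m) ℂ) :
    Var → MvPolynomial (Fin m) ℂ := fun v =>
  if v = .AE 1 then 1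
  else if v = .θE 1 then
    φ (.θ 1) * φ (.θ 2) - φ (.AE 2) * φ (.A 3) * φ (.AE 3) ^ 2 * φ (.A 4) * φ (.AE 4)
  else φ v

/-- The variant of `IsG2Cone` in which the redundant variable `θ_{12}` has been eliminated: a
codimension 5 regular pullback, in `𝔸⁹`, of the specialised cluster variety in `𝔸¹⁶` (all
coordinates but `A_{12}` and `θ_{12}`). -/
structure IsG25Cone (ρ ρE : ZMod 4 → ℤ) (a : Fin 9 → ℤ)
    (φ : Var → MvPolynomial (Fin 9) ℂ) : Prop where
  weight_pos : ∀ k, 0 < a k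
  admissible : ∀ v, v ≠ .AE 1 → v ≠ .θE 1 → IsAdmissibleAt ρ ρE a φ v
  codim : HasCodim (pullbackIdeal (eliminate φ)) 5
  quasismooth : IsQuasismooth (pullbackIdeal (eliminate φ)) 5
  not_ci : ¬ IsCompleteIntersection (pullbackIdeal (eliminate φ))

end G2Format

/-! By the reflection 1 ↔ 2, 3 ↔ 4 it is enough to prove one implication: if d(A_3) < 0 then d(λ_13)
= 0. The four alternatives are then a case split on the signs of d(A_3) and d(A_4).

Suppose d(A_3) < 0 and d(λ_13) ≠ 0. All weights are positive, so A_3 pulls back to 0. Consider the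
locus where the nine functions θ_1, θ_2, θ_4, θ_12, θ_23, θ_34, θ_41, A_41, λ_13 vanish. All
relations vanish there. Since A_12 is a nonzero constant and A_3 = 0, all but six of them have zero
differential there, and two of those six have proportional differentials. Hence the Jacobian has
rank at most 5 < 6 (`grad_relations_mem_span`), and quasismoothness forces the locus to be empty off
the vertex. But nine functions on 𝔸¹⁰ that all vanish at 0 have another common zero
(`exists_ne_zero_common_zero`, by Krull's height theorem and the Nullstellensatz), a contradiction.

It remains to see that the nine functions vanish at 0, that is, have nonzero degree. For A_41 and
λ_13 this is assumed. A θ_i or θ_{i,i+1} of degree 0 would be a nonzero constant, and where such a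
variable is invertible X is a complete intersection: six relations generate the ideal
(`exists_six_generators_of_isUnit_θ`, `exists_six_generators_of_isUnit_θE`), contrary to hypothesis.

With θ_12 eliminated every count drops by one. The relation for θ_1θ_2 becomes 0 = 0, the rank is at
most 4 < 5, the vanishing of θ_12 follows from that of θ_1 and A_3, and eight functions on 𝔸⁹
remain. The complete intersection step now needs five generators, which exist because A_12 is a unit
(`exists_five_generators_of_isUnit`). -/

namespace G2Format

open MvPolynomial

/-! ### Common zeros, spans of differentials, and weighted degrees. -/

section Geometry

variable {m : ℕ}

/-- The projection of `ℂ[y₁, …, yₘ]` that sets the first `k` variables to zero. -/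
noncomputable def killFirst (m k : ℕ) :
    MvPolynomial (Fin m) ℂ →ₐ[ℂ] MvPolynomial (Fin m) ℂ :=
  aeval fun i => if (i : ℕ) < k then 0 else X i

theorem killFirst_succ_comp (k : ℕ) :
    (killFirst m (k + 1)).comp (killFirst m k) = killFirst m (k + 1) := by
  refine MvPolynomial.algHom_ext fun i => ?_
  by_cases h : (i : ℕ) < k
  · have h1 : ¬ k < (i : ℕ) := by omega
    simp [killFirst, h, h1]
  · simp [killFirst, h]

/-- The kernels are the primes generated by initial segments of the variables. They form a strictly
increasing chain, because `X k` lies in kernel k + 1 but not in kernel k (variables are indexed from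
0). -/
theorem le_height_ker_killFirst (k : ℕ) (hk : k ≤ m) :
    (k : ℕ∞) ≤ (RingHom.ker (killFirst m k)).height := by
  induction k with
  | zero => simp
  | succ k ih =>
    have h1 : (RingHom.ker (killFirst m k)).IsPrime := RingHom.ker_isPrime _
    have h2 : (RingHom.ker (killFirst m (k + 1))).IsPrime := RingHom.ker_isPrime _
    have hlt : RingHom.ker (killFirst m k) < RingHom.ker (killFirst m (k + 1)) := by
      refine lt_of_le_of_ne (fun f hf => ?_) fun h => ?_
      · rw [RingHom.mem_ker] at hf ⊢
        rw [← killFirst_succ_comp, AlgHom.comp_apply, hf, map_zero]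
      · have hX : (X ⟨k, hk⟩ : MvPolynomial (Fin m) ℂ) ∈ RingHom.ker (killFirst m k) := by
          rw [h, RingHom.mem_ker]
          simp [killFirst]
        rw [RingHom.mem_ker] at hX
        simp [killFirst] at hX
    calc ((k + 1 : ℕ) : ℕ∞) = k + 1 := by norm_cast
      _ ≤ (RingHom.ker (killFirst m k)).height + 1 := by
        gcongr
        exact ih (Nat.le_of_succ_le hk)
      _ ≤ _ := Ideal.height_add_one_le_of_lt_of_isPrime hlt

/-- Evaluation at 0 factors through `killFirst m m`, so the ideal of the origin contains a kernel of
height at least m. -/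
theorem le_height_vanishingIdeal_zero :
    (m : ℕ∞) ≤ (vanishingIdeal ℂ {(0 : Fin m → ℂ)}).height := by
  refine (le_height_ker_killFirst m le_rfl).trans (Ideal.height_mono fun f hf => ?_)
  rw [RingHom.mem_ker] at hf
  rw [mem_vanishingIdeal_singleton_iff]
  have h : (aeval (0 : Fin m → ℂ)).comp (killFirst m m) = aeval (0 : Fin m → ℂ) :=
    MvPolynomial.algHom_ext fun i => by simp [killFirst]
  rw [← h, AlgHom.comp_apply, hf, map_zero]

/-- Fewer than `m` polynomials in `m` variables that vanish at the origin have another common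
zero. -/
theorem exists_ne_zero_common_zero {n : ℕ} (hn : n < m) (g : Fin n → MvPolynomial (Fin m) ℂ)
    (h0 : ∀ k, eval 0 (g k) = 0) : ∃ p : Fin m → ℂ, p ≠ 0 ∧ ∀ k, eval p (g k) = 0 := by
  by_contra! hno
  have hmin : vanishingIdeal ℂ {(0 : Fin m → ℂ)} ∈ (Ideal.span (Set.range g)).minimalPrimes := by
    refine ⟨⟨?_, ?_⟩, fun Q hQ _ => ?_⟩
    · have : (vanishingIdeal ℂ {(0 : Fin m → ℂ)}).IsMaximal :=
        isMaximal_iff_eq_vanishingIdeal_singleton.2 ⟨0, rfl⟩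
      exact this.isPrime
    · refine Ideal.span_le.2 ?_
      rintro _ ⟨k, rfl⟩
      rw [SetLike.mem_coe, mem_vanishingIdeal_singleton_iff]
      simpa [aeval_eq_eval] using h0 k
    · refine le_trans ?_ ((Ideal.IsPrime.radical_le_iff hQ.1).2 hQ.2)
      rw [← vanishingIdeal_zeroLocus_eq_radical (K := ℂ)]
      refine vanishingIdeal_anti_mono fun p hp => ?_
      by_contra hp0
      obtain ⟨k, hk⟩ := hno p hp0
      exact hk (by simpa [aeval_eq_eval] using hp (g k) (Ideal.subset_span ⟨k, rfl⟩))
  -- Krull's height theorem bounds the height of this minimal prime by the number of generators,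
  -- giving m ≤ n.
  have hle := le_height_vanishingIdeal_zero.trans
    (Ideal.height_le_card_of_mem_minimalPrimes_span (Set.finite_range g) hmin)
  have hcard : (Set.range g).ncard ≤ n := by
    rw [← Nat.card_coe_set_eq]
    exact (Finite.card_range_le g).trans_eq (Nat.card_fin n)
  have : m ≤ (Set.range g).ncard := by exact_mod_cast hle
  omega

/-- The differential of `f` at `p`. -/
noncomputable def grad (p : Fin m → ℂ) : MvPolynomial (Fin m) ℂ →ₗ[ℂ] (Fin m → ℂ) where
  toFun f k := eval p (pderiv k f)
  map_add' f g := by ext; simp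
  map_smul' c f := by ext; simp [smul_eval]

theorem grad_mul (p : Fin m → ℂ) (f g : MvPolynomial (Fin m) ℂ) :
    grad p (f * g) = eval p f • grad p g + eval p g • grad p f := by
  ext k
  simp [grad, Derivation.leibniz]

theorem grad_pow (p : Fin m → ℂ) (f : MvPolynomial (Fin m) ℂ) (n : ℕ) :
    grad p (f ^ n) = (n * eval p f ^ (n - 1)) • grad p f := by
  ext k
  simp [grad, Derivation.leibniz_pow, mul_assoc]

theorem grad_C (p : Fin m → ℂ) (c : ℂ) : grad p (C c) = 0 := by
  ext k
  simp [grad]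

/-- The differentials of all elements of an ideal are spanned by those of its generators. -/
theorem grad_mem_of_mem_span {p : Fin m → ℂ} {S : Set (MvPolynomial (Fin m) ℂ)}
    {W : Submodule ℂ (Fin m → ℂ)} (hS : ∀ r ∈ S, eval p r = 0 ∧ grad p r ∈ W)
    {f : MvPolynomial (Fin m) ℂ} (hf : f ∈ Ideal.span S) : eval p f = 0 ∧ grad p f ∈ W := by
  induction hf using Submodule.span_induction with
  | mem r hr => exact hS r hr
  | zero => simp
  | add f g _ _ hf hg => exact ⟨by simp [hf.1, hg.1], by simpa using W.add_mem hf.2 hg.2⟩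
  | smul g f _ hf =>
    refine ⟨by simp [hf.1], ?_⟩
    -- At a zero of `f` the Leibniz rule keeps only g(p) · df.
    rw [smul_eq_mul, grad_mul, hf.1, zero_smul, add_zero]
    exact W.smul_mem _ hf.2

/-- A quasismooth cone has no point off the vertex where the generators of its ideal vanish and
their differentials span too small a space. -/
theorem IsQuasismooth.eq_zero_of_finrank_lt {S : Set (MvPolynomial (Fin m) ℂ)} {c : ℕ}
    (hq : IsQuasismooth (Ideal.span S) c) {p : Fin m → ℂ} (W : Submodule ℂ (Fin m → ℂ))
    (hW : Module.finrank ℂ W < c) (hS : ∀ r ∈ S, eval p r = 0 ∧ grad p r ∈ W) : p = 0 := by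
  by_contra hp
  have h := hq p hp fun f hf => (grad_mem_of_mem_span hS hf).1
  unfold IsNonsingularAt at h
  rw [← h] at hW
  refine hW.not_ge (Submodule.finrank_mono (Submodule.span_le.2 ?_))
  rintro _ ⟨f, hf, rfl⟩
  exact (grad_mem_of_mem_span hS hf).2

/-- A weighted homogeneous polynomial of degree `0` for positive weights is constant. -/
theorem eq_C_of_isWeightedHomogeneous_zero {a : Fin m → ℤ} (ha : ∀ k, 0 < a k)
    {f : MvPolynomial (Fin m) ℂ} (hf : IsWeightedHomogeneous a f 0) : ∃ c, f = C c := by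
  refine ⟨coeff 0 f, hf.eq_monomial_of_unique_weight fun d hd => ?_⟩
  by_contra hne
  obtain ⟨k, hk⟩ : ∃ k, d k ≠ 0 := by
    by_contra! h
    exact hne (Finsupp.ext h)
  rw [Finsupp.weight_apply, Finsupp.sum] at hd
  have h1 : ∀ i ∈ d.support, 0 ≤ d i • a i := fun i _ => nsmul_nonneg (ha i).le _
  have h2 := (Finset.sum_eq_zero_iff_of_nonneg h1).1 hd k (Finsupp.mem_support_iff.2 hk)
  rcases smul_eq_zero.1 h2 with h | h
  · exact hk h
  · exact (ha k).ne' h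

/-- A weighted homogeneous polynomial of negative degree for positive weights is zero. -/
theorem eq_zero_of_isWeightedHomogeneous_neg {a : Fin m → ℤ} (ha : ∀ k, 0 < a k) {d : ℤ}
    (hd : d < 0) {f : MvPolynomial (Fin m) ℂ} (hf : IsWeightedHomogeneous a f d) : f = 0 := by
  ext e
  rw [coeff_zero]
  refine hf.coeff_eq_zero e fun he => hd.not_ge ?_
  rw [← he, Finsupp.weight_apply]
  exact Finset.sum_nonneg fun i _ => nsmul_nonneg (ha i).le _

/-- A weighted homogeneous polynomial of nonzero degree vanishes at the origin. -/
theorem eval_zero_of_isWeightedHomogeneous {a : Fin m → ℤ} {d : ℤ} (hd : d ≠ 0)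
    {f : MvPolynomial (Fin m) ℂ} (hf : IsWeightedHomogeneous a f d) : eval 0 f = 0 := by
  have h : eval 0 f = coeff 0 f := by
    rw [← constantCoeff_eq, constantCoeff]
    simp [eval, eval₂Hom]
    rfl
  rw [h]
  exact hf.coeff_eq_zero 0 (by simpa using hd.symm)

end Geometry

end G2Format

/-! ### Combinatorics of the relations and their dihedral symmetry. -/

namespace G2Format

/-- The eight dihedral permutations of `(1, 2, 3, 4)`. -/
def dihedral : Finset (ZMod 4 × ZMod 4 × ZMod 4 × ZMod 4) :=
  {(1, 2, 3, 0), (2, 3, 0, 1), (3, 0, 1, 2), (0, 1, 2, 3),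
   (0, 3, 2, 1), (1, 0, 3, 2), (2, 1, 0, 3), (3, 2, 1, 0)}

set_option maxRecDepth 20000 in
theorem exists_eq_of_mem_dihedral : ∀ q ∈ dihedral,
    ∃ i ε : ZMod 4, (ε = 1 ∨ ε = -1) ∧ q = (i, i + ε, i + 2 * ε, i + 3 * ε) := by
  decide

set_option maxRecDepth 20000 in
theorem mem_dihedral : ∀ i ε : ZMod 4, (ε = 1 ∨ ε = -1) →
    (i, i + ε, i + 2 * ε, i + 3 * ε) ∈ dihedral := by
  decide

-- This carries a statement about the first edge of a dihedral tuple to all four of its edges, as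
-- `rel_map` requires.
set_option maxRecDepth 20000 in
theorem dihedral_rotate : ∀ q ∈ dihedral, (q.2.1, q.2.2.1, q.2.2.2, q.1) ∈ dihedral := by
  decide

theorem edge_par_values :
    (edge 1 2 = 1 ∧ edge 2 1 = 1 ∧ edge 2 3 = 2 ∧ edge 3 2 = 2 ∧ edge 3 0 = 3 ∧ edge 0 3 = 3 ∧
      edge 0 1 = 0 ∧ edge 1 0 = 0) ∧ par 0 = 0 ∧ par 1 = 1 ∧ par 2 = 0 ∧ par 3 = 1 := by
  decide

section Relations

variable {R : Type*} [CommRing R]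

theorem mem_relations_iff (x : Var → R) (f : R) : f ∈ relations x ↔ ∃ i j k l,
    (i, j, k, l) ∈ dihedral ∧ (f = rel1 x i j k l ∨ f = rel2 x i j k l ∨ f = rel3 x i j k l ∨
      f = rel4 x i j k l ∨ f = rel5 x i j k l) := by
  constructor
  · rintro ⟨i, ε, hε, h⟩
    exact ⟨_, _, _, _, mem_dihedral i ε hε, h⟩
  · rintro ⟨i, j, k, l, hq, h⟩
    obtain ⟨i', ε, hε, hq⟩ := exists_eq_of_mem_dihedral _ hq
    simp only [Prod.mk.injEq] at hq
    obtain ⟨rfl, rfl, rfl, rfl⟩ := hq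
    exact ⟨_, ε, hε, h⟩

/-- It suffices to check a property of the relations up to repetition. -/
theorem forall_relations (x : Var → R) (P : R → Prop)
    (r1a : P (rel1 x 1 2 3 0)) (r1b : P (rel1 x 2 3 0 1)) (r1c : P (rel1 x 3 0 1 2))
    (r1d : P (rel1 x 0 1 2 3))
    (r2a : P (rel2 x 1 2 3 0)) (r2b : P (rel2 x 2 3 0 1)) (r2c : P (rel2 x 3 0 1 2))
    (r2d : P (rel2 x 0 1 2 3))
    (r3a : P (rel3 x 1 2 3 0)) (r3a' : P (rel3 x 1 0 3 2))
    (r3b : P (rel3 x 2 3 0 1)) (r3b' : P (rel3 x 2 1 0 3))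
    (r3c : P (rel3 x 3 0 1 2)) (r3c' : P (rel3 x 3 2 1 0))
    (r3d : P (rel3 x 0 1 2 3)) (r3d' : P (rel3 x 0 3 2 1))
    (r4a : P (rel4 x 1 2 3 0)) (r4b : P (rel4 x 2 3 0 1))
    (r5a : P (rel5 x 1 2 3 0)) (r5b : P (rel5 x 2 3 0 1)) : ∀ f ∈ relations x, P f := by
  intro f hf
  obtain ⟨⟨e1, e2, e3, e4, e5, e6, e7, e8⟩, p0, p1, p2, p3⟩ := edge_par_values
  rw [mem_relations_iff] at hf
  obtain ⟨i, j, k, l, hq, h⟩ := hf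
  simp only [dihedral, Finset.mem_insert, Finset.mem_singleton, Prod.mk.injEq] at hq
  rcases hq with ⟨rfl, rfl, rfl, rfl⟩ | ⟨rfl, rfl, rfl, rfl⟩ | ⟨rfl, rfl, rfl, rfl⟩ |
    ⟨rfl, rfl, rfl, rfl⟩ | ⟨rfl, rfl, rfl, rfl⟩ | ⟨rfl, rfl, rfl, rfl⟩ | ⟨rfl, rfl, rfl, rfl⟩ |
    ⟨rfl, rfl, rfl, rfl⟩ <;> rcases h with rfl | rfl | rfl | rfl | rfl <;> try assumption
  -- Of the 40 pairs of a tuple and a family, 20 are the hypotheses. The other 20 repeat them: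
  -- families 1 and 2 are each fixed by one reflection of the tuple, families 4 and 5 by a subgroup
  -- of order four.
  all_goals
    simp only [rel1, rel2, rel4, rel5, e1, e2, e3, e4, e5, e6, e7, e8, p0, p1, p2, p3] at *
  · convert r4a using 1; ring
  · convert r5a using 1; ring
  · convert r4b using 1; ring
  · convert r5b using 1; ring
  · convert r1c using 1; ring
  · convert r2b using 1; ring
  · convert r4b using 1; ring
  · convert r5a using 1; ring
  · convert r1d using 1; ring
  · convert r2c using 1; ring
  · convert r4a using 1; ring
  · convert r5b using 1; ring
  · convert r1a using 1; ring
  · convert r2d using 1; ring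
  · convert r4b using 1; ring
  · convert r5a using 1; ring
  · convert r1b using 1; ring
  · convert r2a using 1; ring
  · convert r4a using 1; ring
  · convert r5b using 1; ring

theorem map_rel {S : Type*} [CommRing S] (f : R →+* S) (x : Var → R) (i j k l : ZMod 4) :
    f (rel1 x i j k l) = rel1 (f ∘ x) i j k l ∧ f (rel2 x i j k l) = rel2 (f ∘ x) i j k l ∧
    f (rel3 x i j k l) = rel3 (f ∘ x) i j k l ∧ f (rel4 x i j k l) = rel4 (f ∘ x) i j k l ∧
    f (rel5 x i j k l) = rel5 (f ∘ x) i j k l := by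
  simp [rel1, rel2, rel3, rel4, rel5]

theorem relations_comp {S : Type*} [CommRing S] (f : R →+* S) (x : Var → R) :
    relations (f ∘ x) = f '' relations x := by
  ext y
  constructor
  · rintro ⟨i, ε, hε, h⟩
    obtain ⟨h1, h2, h3, h4, h5⟩ := map_rel f x i (i + ε) (i + 2 * ε) (i + 3 * ε)
    rw [← h1, ← h2, ← h3, ← h4, ← h5] at h
    rcases h with rfl | rfl | rfl | rfl | rfl <;>
      exact ⟨_, ⟨i, ε, hε, by simp⟩, rfl⟩
  · rintro ⟨_, ⟨i, ε, hε, h⟩, rfl⟩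
    obtain ⟨h1, h2, h3, h4, h5⟩ := map_rel f x i (i + ε) (i + 2 * ε) (i + 3 * ε)
    refine ⟨i, ε, hε, ?_⟩
    rw [← h1, ← h2, ← h3, ← h4, ← h5]
    rcases h with rfl | rfl | rfl | rfl | rfl <;> simp

/-- The action on coordinates of a symmetry of the 4-cycle, given by its actions on vertices,
edges and diagonals. -/
def Var.map (g gE : ZMod 4 → ZMod 4) (gD : ZMod 2 → ZMod 2) : Var → Var
  | .θ i => .θ (g i)
  | .θE i => .θE (gE i)
  | .A i => .A (g i)
  | .AE i => .AE (gE i)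
  | .lam p => .lam (gD p)

/-- The relations only involve edges between cyclically consecutive entries of a tuple, so `hE`
applied to the tuple and its three rotations is enough. -/
theorem rel_map (x : Var → R) {g gE : ZMod 4 → ZMod 4} {gD : ZMod 2 → ZMod 2}
    (hE : ∀ q ∈ dihedral, edge (g q.1) (g q.2.1) = gE (edge q.1 q.2.1))
    (hD : ∀ i, par (g i) = gD (par i)) {i j k l : ZMod 4} (hq : (i, j, k, l) ∈ dihedral) :
    rel1 (x ∘ Var.map g gE gD) i j k l = rel1 x (g i) (g j) (g k) (g l) ∧
    rel2 (x ∘ Var.map g gE gD) i j k l = rel2 x (g i) (g j) (g k) (g l) ∧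
    rel3 (x ∘ Var.map g gE gD) i j k l = rel3 x (g i) (g j) (g k) (g l) ∧
    rel4 (x ∘ Var.map g gE gD) i j k l = rel4 x (g i) (g j) (g k) (g l) ∧
    rel5 (x ∘ Var.map g gE gD) i j k l = rel5 x (g i) (g j) (g k) (g l) := by
  have h2 := dihedral_rotate _ hq
  have h3 := dihedral_rotate _ h2
  have h4 := dihedral_rotate _ h3
  have e1 := hE _ hq
  have e2 := hE _ h2
  have e3 := hE _ h3
  have e4 := hE _ h4
  simp only at e1 e2 e3 e4
  simp only [rel1, rel2, rel3, rel4, rel5, Function.comp_apply, Var.map, e1, e2, e3, e4, hD,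
    and_self]

/-- The set of relations is invariant under symmetries of the 4-cycle. -/
theorem relations_map_subset (x : Var → R) {g gE : ZMod 4 → ZMod 4} {gD : ZMod 2 → ZMod 2}
    (hg : ∀ q ∈ dihedral, (g q.1, g q.2.1, g q.2.2.1, g q.2.2.2) ∈ dihedral)
    (hE : ∀ q ∈ dihedral, edge (g q.1) (g q.2.1) = gE (edge q.1 q.2.1))
    (hD : ∀ i, par (g i) = gD (par i)) :
    relations (x ∘ Var.map g gE gD) ⊆ relations x := by
  intro f hf
  rw [mem_relations_iff] at hf ⊢
  obtain ⟨i, j, k, l, hq, h⟩ := hf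
  obtain ⟨h1, h2, h3, h4, h5⟩ := rel_map x hE hD hq
  rw [h1, h2, h3, h4, h5] at h
  exact ⟨_, _, _, _, hg _ hq, h⟩

/-- Rotation of the labels by `r`. -/
def Var.rotate (r : ZMod 4) : Var → Var :=
  Var.map (· + r) (· + r) (· + par r)

/-- Reflection of the labels, exchanging `1` with `2` and `3` with `4`. -/
def Var.reflect : Var → Var :=
  Var.map (3 - ·) (2 - ·) (· + 1)

set_option maxRecDepth 20000 in
theorem edge_add : ∀ r, ∀ q ∈ dihedral, edge (q.1 + r) (q.2.1 + r) = edge q.1 q.2.1 + r := by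
  decide

-- The reflection sends the edge {e, e + 1} to {3 - e, 2 - e}, which starts at 2 - e. This is why
-- vertices and edges are reflected by different formulas.
set_option maxRecDepth 20000 in
theorem edge_sub : ∀ q ∈ dihedral, edge (3 - q.1) (3 - q.2.1) = 2 - edge q.1 q.2.1 := by
  decide

set_option maxRecDepth 20000 in
theorem par_add : ∀ r i, par (i + r) = par i + par r := by
  decide

theorem par_sub : ∀ i, par (3 - i) = par i + 1 := by
  decide

set_option maxRecDepth 20000 in
theorem dihedral_add : ∀ r, ∀ q ∈ dihedral,
    (q.1 + r, q.2.1 + r, q.2.2.1 + r, q.2.2.2 + r) ∈ dihedral := by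
  decide

set_option maxRecDepth 20000 in
theorem dihedral_sub : ∀ q ∈ dihedral,
    (3 - q.1, 3 - q.2.1, 3 - q.2.2.1, 3 - q.2.2.2) ∈ dihedral := by
  decide

theorem Var.rotate_rotate_neg (r : ZMod 4) (v : Var) : (v.rotate (-r)).rotate r = v := by
  have h : par (-r) + par r = 0 := by
    revert r
    decide
  cases v <;> simp [Var.rotate, Var.map, add_assoc, h]

theorem Var.reflect_reflect (v : Var) : v.reflect.reflect = v := by
  have h : (1 + 1 : ZMod 2) = 0 := by decide
  cases v <;> simp [Var.reflect, Var.map, add_assoc, h]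

/-- One inclusion holds for every rotation; using it for -r on the rotated coordinates gives the
other. -/
theorem relations_comp_rotate (x : Var → R) (r : ZMod 4) :
    relations (x ∘ Var.rotate r) = relations x := by
  have h (y : Var → R) (r : ZMod 4) : relations (y ∘ Var.rotate r) ⊆ relations y :=
    relations_map_subset y (dihedral_add r) (edge_add r) (par_add r)
  refine (h x r).antisymm ?_
  have h2 := h (x ∘ Var.rotate r) (-r)
  rwa [Function.comp_assoc, show Var.rotate r ∘ Var.rotate (-r) = id from
    funext (Var.rotate_rotate_neg r)] at h2

theorem relations_comp_reflect (x : Var → R) : relations (x ∘ Var.reflect) = relations x := by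
  have h (y : Var → R) : relations (y ∘ Var.reflect) ⊆ relations y :=
    relations_map_subset y dihedral_sub edge_sub par_sub
  refine (h x).antisymm ?_
  have h2 := h (x ∘ Var.reflect)
  rwa [Function.comp_assoc, show Var.reflect ∘ Var.reflect = id from
    funext Var.reflect_reflect] at h2

/-! ### Explicit identities between the relations on the loci where a theta variable is invertible.
-/

/-- Where `θ_1` is invertible, six relations imply all others. -/
theorem relations_eq_zero_of_isUnit_θ_one (x : Var → R) (h : IsUnit (x (.θ 1)))
    (g31 : rel3 x 1 2 3 0 = 0) (g31n : rel3 x 1 0 3 2 = 0) (g41 : rel4 x 1 2 3 0 = 0)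
    (g11 : rel1 x 1 2 3 0 = 0) (g10 : rel1 x 0 1 2 3 = 0) (g20 : rel2 x 0 1 2 3 = 0) :
    ∀ f ∈ relations x, f = 0 := by
  obtain ⟨⟨e1, e2, e3, e4, e5, e6, e7, e8⟩, p0, p1, p2, p3⟩ := edge_par_values
  -- With θ_1 invertible the six relations solve in turn for θ_2, θ_4, A_1, θ_3, θ_23 and θ_34, so
  -- they cut out a graph over the other 12 coordinates. Each remaining relation, multiplied by a
  -- power of θ_1, is the combination of the six displayed below.
  refine forall_relations x _ g11 ?_ ?_ g10 ?_ ?_ ?_ g20 g31 g31n ?_ ?_ ?_ ?_ ?_ ?_ g41 ?_ ?_ ?_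
  all_goals
    simp only [rel1, rel2, rel3, rel4, rel5, e1, e2, e3, e4, e5, e6, e7, e8, p0, p1, p2, p3] at *
    -- The index 0 stands for the label 4; thus `b30` is A_34 and `b01` is A_41. Moreover `u` is
    -- λ_13 and `v` is λ_24.
    generalize x (.θ 1) = t1, x (.θ 2) = t2, x (.θ 3) = t3, x (.θ 0) = t0, x (.θE 1) = t12,
    x (.θE 2) = t23, x (.θE 3) = t30, x (.θE 0) = t01, x (.A 1) = a1, x (.A 2) = a2,
    x (.A 3) = a3, x (.A 0) = a0, x (.AE 1) = b12, x (.AE 2) = b23, x (.AE 3) = b30,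
    x (.AE 0) = b01, x (.lam 1) = u, x (.lam 0) = v at *
  · refine (h.pow 3).mul_right_eq_zero.1 ?_
    linear_combination
      (-t1 ^ 2 * b23) * g31 + (t1 ^ 2 * t2 - t1 * a3 * a0 * b23 * b30 ^ 2 * b01) * g41 + (t1 * t0
      * a0 * b30 * b01 - a2 * a3 * a0 * b12 * b23 ^ 2 * b30 ^ 2 * b01) * g11 + (t12 * a0 * b12 *
      b30 * b01) * g10 + (a0 * b12 * b30 * b01 ^ 2) * g20
  · refine (h.pow 3).mul_right_eq_zero.1 ?_
    linear_combination
      (-t1 ^ 2 * b30) * g31n + (t1 ^ 2 * t0 - t1 * a2 * a3 * b12 * b23 ^ 2 * b30) * g41 + (t1 *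
      t0 * a2 * b12 * b23 - a2 ^ 2 * a3 * b12 ^ 2 * b23 ^ 3 * b30) * g11 + (t12 * a2 * b12 ^ 2 *
      b23) * g10 + (a2 * b12 ^ 2 * b23 * b01) * g20
  · refine (h.pow 3).mul_right_eq_zero.1 ?_
    linear_combination
      (t1 ^ 2 * t12) * g31 + (t1 * t12 * a3 * a0 * b30 ^ 2 * b01) * g41 + (-t1 ^ 2 * t2 ^ 2 * a2
      - t1 ^ 2 * t2 * b30 * b01 * v - t1 ^ 2 * a0 * b30 ^ 2 * b01 ^ 2 * u - t1 * t2 * a2 * a3 *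
      a0 * b23 * b30 ^ 2 * b01 - t1 * a3 * a0 * b23 * b30 ^ 3 * b01 ^ 2 * v - a2 * a3 ^ 2 * a0 ^
      2 * b23 ^ 2 * b30 ^ 4 * b01 ^ 2) * g11 + (t12 * a3 * a0 ^ 2 * b30 ^ 3 * b01 ^ 2) * g10 +
      (a3 * a0 ^ 2 * b30 ^ 3 * b01 ^ 3) * g20
  · refine (h.pow 6).mul_right_eq_zero.1 ?_
    linear_combination
      (t1 ^ 5 * t30) * g31 + (t1 ^ 4 * t2 ^ 2 * a2 * b12 + t1 ^ 4 * t2 * b12 * b30 * b01 * v + t1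
      ^ 4 * a0 * b12 * b30 ^ 2 * b01 ^ 2 * u + t1 ^ 4 * t3 * a3 * a0 * b30 ^ 2 * b01) * g31n +
      (-t1 ^ 5 * t3 ^ 2 * a3 - t1 ^ 5 * t3 * b12 * b01 * u - t1 ^ 5 * a1 * b12 ^ 2 * b01 ^ 2 * v
      - t1 ^ 4 * t2 * t3 * a2 * a3 * b12 * b23 - t1 ^ 4 * t3 * a3 * b12 * b23 * b30 * b01 * v -
      t1 ^ 4 * t3 * t0 * a3 * a0 * b30 * b01 - t1 ^ 4 * t2 * a2 * b12 ^ 2 * b23 * b01 * u - t1 ^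
      4 * b12 ^ 2 * b23 * b30 * b01 ^ 2 * u * v - t1 ^ 4 * t0 * a0 * b12 * b30 * b01 ^ 2 * u + 2
      * t1 ^ 3 * a2 * a3 * a0 * b12 ^ 2 * b23 ^ 2 * b30 ^ 2 * b01 ^ 2 * u + t1 ^ 3 * t3 * a2 * a3
      ^ 2 * a0 * b12 * b23 ^ 2 * b30 ^ 2 * b01 - 2 * t1 ^ 3 * t2 * t0 * a2 * a3 * a0 * b12 * b23
      * b30 * b01 - t1 ^ 3 * t2 * a2 * a3 * b12 ^ 2 * b23 ^ 2 * b30 * b01 * v - t1 ^ 3 * a3 * b12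
      ^ 2 * b23 ^ 2 * b30 ^ 2 * b01 ^ 2 * v ^ 2 - t1 ^ 3 * t0 * a3 * a0 * b12 * b23 * b30 ^ 2 *
      b01 ^ 2 * v + t1 ^ 2 * t2 * a2 ^ 2 * a3 ^ 2 * a0 * b12 ^ 2 * b23 ^ 3 * b30 ^ 2 * b01 + t1 ^
      2 * a2 * a3 ^ 2 * a0 * b12 ^ 2 * b23 ^ 3 * b30 ^ 3 * b01 ^ 2 * v + t1 ^ 2 * t0 * a2 * a3 ^
      2 * a0 ^ 2 * b12 * b23 ^ 2 * b30 ^ 3 * b01 ^ 2) * g41 + (-t1 ^ 4 * a1 * a2 * b12 ^ 3 * b23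
      * b01 ^ 2 * v + t1 ^ 3 * t2 * t0 ^ 2 * a2 * a0 * b12 * b01 + t1 ^ 3 * t2 * t0 * a2 * b12 ^
      2 * b23 * b01 * v + t1 ^ 3 * t0 ^ 2 * a0 * b12 * b30 * b01 ^ 2 * v + t1 ^ 3 * t0 * b12 ^ 2
      * b23 * b30 * b01 ^ 2 * v ^ 2 - 2 * t1 ^ 3 * t0 * a2 * a0 * b12 ^ 2 * b23 * b30 * b01 ^ 2 *
      u - t1 ^ 3 * a2 * b12 ^ 3 * b23 ^ 2 * b30 * b01 ^ 2 * u * v + t1 ^ 2 * t0 ^ 2 * t12 * a2 *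
      a0 * b12 ^ 2 * b01 - t1 ^ 2 * t0 ^ 2 * a2 * a3 * a0 ^ 2 * b12 * b23 * b30 ^ 2 * b01 ^ 2 +
      t1 ^ 2 * t0 * t12 * a2 * b12 ^ 3 * b23 * b01 * v - 3 * t1 ^ 2 * t0 * a2 * a3 * a0 * b12 ^ 2
      * b23 ^ 2 * b30 ^ 2 * b01 ^ 2 * v + 2 * t1 ^ 2 * a2 ^ 2 * a3 * a0 * b12 ^ 3 * b23 ^ 3 * b30
      ^ 2 * b01 ^ 2 * u - 2 * t1 ^ 2 * t2 * t0 * a2 ^ 2 * a3 * a0 * b12 ^ 2 * b23 ^ 2 * b30 * b01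
      - t1 ^ 2 * t2 * a2 ^ 2 * a3 * b12 ^ 3 * b23 ^ 3 * b30 * b01 * v - 2 * t1 ^ 2 * a2 * a3 *
      b12 ^ 3 * b23 ^ 3 * b30 ^ 2 * b01 ^ 2 * v ^ 2 + t1 * t2 * a2 ^ 3 * a3 ^ 2 * a0 * b12 ^ 3 *
      b23 ^ 4 * b30 ^ 2 * b01 + t1 * a2 ^ 2 * a3 ^ 2 * a0 * b12 ^ 3 * b23 ^ 4 * b30 ^ 3 * b01 ^ 2
      * v - 2 * t1 * t0 * t12 * a2 ^ 2 * a3 * a0 * b12 ^ 3 * b23 ^ 2 * b30 * b01 - t1 * t12 * a2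
      ^ 2 * a3 * b12 ^ 4 * b23 ^ 3 * b30 * b01 * v + t12 * a2 ^ 3 * a3 ^ 2 * a0 * b12 ^ 4 * b23 ^
      4 * b30 ^ 2 * b01 + a2 ^ 3 * a3 ^ 3 * a0 ^ 2 * b12 ^ 3 * b23 ^ 5 * b30 ^ 4 * b01 ^ 2) * g11
      + (-t1 ^ 4 * a1 * a0 * b12 ^ 2 * b30 * b01 ^ 3 * v - t1 ^ 3 * a0 * b12 ^ 2 * b23 * b30 ^ 2
      * b01 ^ 3 * u * v + t1 ^ 2 * t0 * t12 * a0 * b12 ^ 2 * b30 * b01 ^ 2 * v + t1 ^ 2 * t12 *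
      b12 ^ 3 * b23 * b30 * b01 ^ 2 * v ^ 2 - t1 ^ 2 * a3 * a0 * b12 ^ 2 * b23 ^ 2 * b30 ^ 3 *
      b01 ^ 3 * v ^ 2 - 2 * t1 ^ 2 * t12 * a2 * a0 * b12 ^ 3 * b23 * b30 * b01 ^ 2 * u + t1 * t0
      * t12 ^ 2 * a2 * a0 * b12 ^ 3 * b01 + t1 * t12 ^ 2 * a2 * b12 ^ 4 * b23 * b01 * v - t1 *
      t12 * a2 * a3 * a0 * b12 ^ 3 * b23 ^ 2 * b30 ^ 2 * b01 ^ 2 * v - t1 * a2 * a3 ^ 2 * a0 ^ 2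
      * b12 ^ 2 * b23 ^ 3 * b30 ^ 4 * b01 ^ 3 * v + t1 * t12 * t01 * a0 * b12 ^ 2 * b30 * b01 ^ 3
      * v + t12 ^ 2 * t01 * a2 * a0 * b12 ^ 3 * b01 ^ 2 - t12 ^ 2 * a2 ^ 2 * a3 * a0 * b12 ^ 4 *
      b23 ^ 2 * b30 * b01 - 2 * t12 * a2 ^ 2 * a3 ^ 2 * a0 ^ 2 * b12 ^ 3 * b23 ^ 3 * b30 ^ 3 *
      b01 ^ 2) * g10 + (t1 ^ 2 * b12 ^ 3 * b23 * b30 * b01 ^ 3 * v ^ 2 - t1 ^ 2 * a2 * a0 * b12 ^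
      3 * b23 * b30 * b01 ^ 3 * u + t1 * t12 * a2 * b12 ^ 4 * b23 * b01 ^ 2 * v + t1 * t01 * a0 *
      b12 ^ 2 * b30 * b01 ^ 4 * v + t12 * t01 * a2 * a0 * b12 ^ 3 * b01 ^ 3 - a2 ^ 2 * a3 ^ 2 *
      a0 ^ 2 * b12 ^ 3 * b23 ^ 3 * b30 ^ 3 * b01 ^ 3 + t1 ^ 3 * a1 * a2 * a0 * b12 ^ 3 * b01 ^ 3
      + t1 * a2 * a3 * a0 * b12 ^ 3 * b23 ^ 2 * b30 ^ 2 * b01 ^ 3 * v) * g20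
  · refine (h.pow 3).mul_right_eq_zero.1 ?_
    linear_combination
      (t1 ^ 2 * t01) * g31n + (t1 * t01 * a2 * a3 * b12 * b23 ^ 2) * g41 + (t01 * a2 ^ 2 * a3 *
      b12 ^ 2 * b23 ^ 3) * g11 + (-t1 ^ 2 * t0 ^ 2 * a0 - t1 ^ 2 * t0 * b12 * b23 * v - t1 ^ 2 *
      a2 * b12 ^ 2 * b23 ^ 2 * u - t1 * t0 * a2 * a3 * a0 * b12 * b23 ^ 2 * b30 - t1 * a2 * a3 *
      b12 ^ 2 * b23 ^ 3 * b30 * v - a2 ^ 2 * a3 ^ 2 * a0 * b12 ^ 2 * b23 ^ 4 * b30 ^ 2) * g10 +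
      (a2 ^ 2 * a3 * b12 ^ 3 * b23 ^ 3) * g20
  · refine (h.pow 3).mul_right_eq_zero.1 ?_
    linear_combination
      (t1 ^ 2 * t2) * g31n + (-t1 ^ 2 * t3 * a3 * b23 - t1 ^ 2 * b12 * b23 * b01 * u - t1 * a3 *
      b12 * b23 ^ 2 * b30 * b01 * v - t1 * t0 * a3 * a0 * b23 * b30 * b01) * g41 + (t1 * t0 ^ 2 *
      a0 * b01 + t1 * t0 * b12 * b23 * b01 * v - a2 * a3 * b12 ^ 2 * b23 ^ 3 * b30 * b01 * v - t0
      * a2 * a3 * a0 * b12 * b23 ^ 2 * b30 * b01) * g11 + (t0 * t12 * a0 * b12 * b01 + t12 * b12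
      ^ 2 * b23 * b01 * v) * g10 + (t0 * a0 * b12 * b01 ^ 2 + b12 ^ 2 * b23 * b01 ^ 2 * v) * g20
  · refine (h.pow 1).mul_right_eq_zero.1 ?_
    linear_combination
      (t01) * g11 + (-a3 * a0 * b23 * b30 ^ 2) * g10 + (b12) * g20
  · refine (h.pow 2).mul_right_eq_zero.1 ?_
    linear_combination
      (t1 * t01) * g41 + (t01 * a2 * b12 * b23) * g11 + (-t1 * t0 * a0 * b30 - t1 * b12 * b23 *
      b30 * v - a2 * a3 * a0 * b12 * b23 ^ 2 * b30 ^ 2) * g10 + (a2 * b12 ^ 2 * b23) * g20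
  · refine (h.pow 2).mul_right_eq_zero.1 ?_
    linear_combination
      (t1 * t12) * g41 + (-t1 * t2 * a2 * b23 - t1 * b23 * b30 * b01 * v - a2 * a3 * a0 * b23 ^ 2
      * b30 ^ 2 * b01) * g11 + (t12 * a0 * b30 * b01) * g10 + (a0 * b30 * b01 ^ 2) * g20
  · refine (h.pow 1).mul_right_eq_zero.1 ?_
    linear_combination
      (-a2 * a3 * b23 ^ 2 * b30) * g11 + (t12) * g10 + (b01) * g20
  · refine (h.pow 4).mul_right_eq_zero.1 ?_
    linear_combination
      (t1 ^ 3 * t0) * g31 + (-t1 ^ 3 * t3 * a3 * b30 - t1 ^ 3 * b12 * b30 * b01 * u - t1 ^ 2 * t2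
      * a2 * a3 * b12 * b23 * b30 - t1 ^ 2 * a3 * b12 * b23 * b30 ^ 2 * b01 * v) * g41 + (-t1 ^ 3
      * a1 * a2 * b12 ^ 2 * b01 + t1 ^ 2 * t2 * t0 * a2 * b12 + t1 ^ 2 * t0 * b12 * b30 * b01 * v
      - t1 ^ 2 * a2 * b12 ^ 2 * b23 * b30 * b01 * u + t1 * t0 * t12 * a2 * b12 ^ 2 - t1 * t2 * a2
      ^ 2 * a3 * b12 ^ 2 * b23 ^ 2 * b30 - 2 * t1 * a2 * a3 * b12 ^ 2 * b23 ^ 2 * b30 ^ 2 * b01 *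
      v - t12 * a2 ^ 2 * a3 * b12 ^ 3 * b23 ^ 2 * b30 - a2 ^ 2 * a3 ^ 2 * a0 * b12 ^ 2 * b23 ^ 3
      * b30 ^ 3 * b01) * g11 + (t1 * t12 * b12 ^ 2 * b30 * b01 * v + t12 ^ 2 * a2 * b12 ^ 3 + t12
      * a2 * a3 * a0 * b12 ^ 2 * b23 * b30 ^ 2 * b01) * g10 + (t1 * b12 ^ 2 * b30 * b01 ^ 2 * v +
      t12 * a2 * b12 ^ 3 * b01 + a2 * a3 * a0 * b12 ^ 2 * b23 * b30 ^ 2 * b01 ^ 2) * g20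
  · refine (h.pow 2).mul_right_eq_zero.1 ?_
    linear_combination
      (-t1 * a3 * b23 * b30) * g41 + (t1 * t0 - a2 * a3 * b12 * b23 ^ 2 * b30) * g11 + (t12 *
      b12) * g10 + (b12 * b01) * g20
  · refine (h.pow 3).mul_right_eq_zero.1 ?_
    linear_combination
      (t1 ^ 2 * t12) * g31n + (-t1 ^ 2 * t2 * a2 * a3 * b23 ^ 2 - t1 ^ 3 * b23 * b01 * u + t1 *
      t12 * a2 * a3 * b12 * b23 ^ 2) * g41 + (-t1 ^ 2 * t0 * b23 * b01 * v - t1 * t2 * a2 ^ 2 *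
      a3 * b12 * b23 ^ 3 - t1 * a2 * a3 * b12 * b23 ^ 3 * b30 * b01 * v - t1 * t0 * a2 * a3 * a0
      * b23 ^ 2 * b30 * b01 - t1 ^ 2 * a2 * b12 * b23 ^ 2 * b01 * u - a2 ^ 2 * a3 ^ 2 * a0 * b12
      * b23 ^ 4 * b30 ^ 2 * b01) * g11 + (-t1 ^ 3 * a1 * a0 * b01 ^ 2 + t1 * t0 * t12 * a0 * b01
      - t1 ^ 2 * a0 * b23 * b30 * b01 ^ 2 * u - t1 * a3 * a0 * b23 ^ 2 * b30 ^ 2 * b01 ^ 2 * v +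
      t12 * t01 * a0 * b01 ^ 2 + t12 * a2 * a3 * a0 * b12 * b23 ^ 2 * b30 * b01 - a2 * a3 ^ 2 *
      a0 ^ 2 * b23 ^ 3 * b30 ^ 3 * b01 ^ 2) * g10 + (t01 * a0 * b01 ^ 3 + 2 * a2 * a3 * a0 * b12
      * b23 ^ 2 * b30 * b01 ^ 2) * g20
  · refine (h.pow 3).mul_right_eq_zero.1 ?_
    linear_combination
      (t1 ^ 2 * t01) * g31 + (-t1 ^ 2 * t0 * a3 * a0 * b30 ^ 2 - t1 ^ 3 * b12 * b30 * u + t1 *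
      t01 * a3 * a0 * b30 ^ 2 * b01) * g41 + (-t1 ^ 2 * t0 * b12 * b30 * v - t1 ^ 3 * a1 * a2 *
      b12 ^ 2 + t1 * t2 * t01 * a2 * b12 + t1 * t01 * b12 * b30 * b01 * v - t1 * t0 * a2 * a3 *
      a0 * b12 * b23 * b30 ^ 2 - t1 ^ 2 * a2 * b12 ^ 2 * b23 * b30 * u + t12 * t01 * a2 * b12 ^ 2
      + 2 * t01 * a2 * a3 * a0 * b12 * b23 * b30 ^ 2 * b01) * g11 + (-2 * t1 * a3 * a0 * b12 *
      b23 * b30 ^ 3 * b01 * v - t1 * t0 * a3 * a0 ^ 2 * b30 ^ 3 * b01 - t1 * t12 * b12 ^ 2 * b30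
      * v - t1 ^ 2 * a0 * b12 * b30 ^ 2 * b01 * u - t12 * a2 * a3 * a0 * b12 ^ 2 * b23 * b30 ^ 2
      - 2 * a2 * a3 ^ 2 * a0 ^ 2 * b12 * b23 ^ 2 * b30 ^ 4 * b01) * g10 + (t12 * a2 * b12 ^ 3 + 2
      * a2 * a3 * a0 * b12 ^ 2 * b23 * b30 ^ 2 * b01) * g20

/-- Where `θ_{12}` is invertible, six relations imply all others. -/
theorem relations_eq_zero_of_isUnit_θE_one (x : Var → R) (h : IsUnit (x (.θE 1)))
    (g51 : rel5 x 1 2 3 0 = 0) (g21 : rel2 x 1 2 3 0 = 0) (g20 : rel2 x 0 1 2 3 = 0)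
    (g33n : rel3 x 3 2 1 0 = 0) (g30 : rel3 x 0 1 2 3 = 0) (g11 : rel1 x 1 2 3 0 = 0) :
    ∀ f ∈ relations x, f = 0 := by
  obtain ⟨⟨e1, e2, e3, e4, e5, e6, e7, e8⟩, p0, p1, p2, p3⟩ := edge_par_values
  -- With θ_12 invertible the six relations solve for A_12, θ_23, θ_41, θ_3, θ_4 and then θ_34,
  -- again giving a graph over 12 coordinates.
  refine forall_relations x _ g11 ?_ ?_ ?_ g21 ?_ ?_ g20 ?_ ?_ ?_ ?_ ?_ g33n g30 ?_ ?_ ?_ g51 ?_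
  all_goals
    simp only [rel1, rel2, rel3, rel4, rel5, e1, e2, e3, e4, e5, e6, e7, e8, p0, p1, p2, p3] at *
    generalize x (.θ 1) = t1, x (.θ 2) = t2, x (.θ 3) = t3, x (.θ 0) = t0, x (.θE 1) = t12,
    x (.θE 2) = t23, x (.θE 3) = t30, x (.θE 0) = t01, x (.A 1) = a1, x (.A 2) = a2,
    x (.A 3) = a3, x (.A 0) = a0, x (.AE 1) = b12, x (.AE 2) = b23, x (.AE 3) = b30,
    x (.AE 0) = b01, x (.lam 1) = u, x (.lam 0) = v at *
  · refine (h.pow 1).mul_right_eq_zero.1 ?_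
    linear_combination
      (-b23) * g21 + (t2) * g33n + (a1 * a0 * b30 * b01 ^ 2) * g11
  · refine (h.pow 2).mul_right_eq_zero.1 ?_
    linear_combination
      (-t12 * b30) * g51 + (t0 * t12 - t2 * a2 * a3 * b23 ^ 2 * b30 - t1 * b23 * b30 * b01 * u) *
      g33n + (t2 ^ 2 * a2 * b23 + a0 * b23 * b30 ^ 2 * b01 ^ 2 * u) * g30 + (t1 * t2 * a1 * a2 *
      b23 * b01 - b23 ^ 2 * b30 ^ 2 * b01 ^ 2 * u * v + t12 * a1 * a2 * b12 * b23 * b01) * g11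
  · refine (h.pow 1).mul_right_eq_zero.1 ?_
    linear_combination
      (-b01) * g20 + (t1) * g30 + (a2 * a3 * b23 ^ 2 * b30) * g11
  · refine (h.pow 3).mul_right_eq_zero.1 ?_
    linear_combination
      (t12 ^ 2 * t23) * g51 + (t2 * t3 * t12 * a2 * a3 * b23 ^ 2 + t1 * t3 * t12 * b23 * b01 * u
      + t2 * t0 * t12 * b23 * b01 * v + t1 * t0 * t12 * a1 * a0 * b01 ^ 2 + t12 * a1 * a2 * a3 *
      a0 * b12 * b23 ^ 2 * b30 * b01 ^ 2 - t12 * b12 * b23 ^ 2 * b30 * b01 ^ 2 * u * v) * g21 +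
      (-t3 ^ 2 * t12 ^ 2 * a3 - t3 * t12 ^ 2 * b12 * b01 * u - t12 ^ 2 * a1 * b12 ^ 2 * b01 ^ 2 *
      v - t2 ^ 2 * t3 * t12 * a2 * a3 * b23 - t2 * t3 * t12 * a3 * b23 * b30 * b01 * v - t3 * t12
      * a3 * a0 * b23 * b30 ^ 2 * b01 ^ 2 * u - t1 * t3 * t12 * a1 * a3 * a0 * b30 * b01 ^ 2 - t2
      ^ 2 * t12 * a2 * b12 * b23 * b01 * u - t2 * t12 * b12 * b23 * b30 * b01 ^ 2 * u * v - t12 *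
      a0 * b12 * b23 * b30 ^ 2 * b01 ^ 3 * u ^ 2 - t1 * t12 * a1 * a0 * b12 * b30 * b01 ^ 3 * u +
      t2 * a1 * a2 * a3 ^ 2 * a0 ^ 2 * b23 ^ 2 * b30 ^ 3 * b01 ^ 3 + t1 * t2 ^ 3 * a2 * b23 * b01
      * u + t1 * t2 ^ 2 * b23 * b30 * b01 ^ 2 * u * v + t1 * t2 * a0 * b23 * b30 ^ 2 * b01 ^ 3 *
      u ^ 2 - 2 * t1 * t2 ^ 2 * a1 * a2 * a3 * a0 * b23 * b30 * b01 ^ 2 - t2 ^ 3 * a2 * a3 * b23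
      ^ 2 * b30 * b01 * v - t2 ^ 2 * a3 * b23 ^ 2 * b30 ^ 2 * b01 ^ 2 * v ^ 2 - 2 * t2 * a3 * a0
      * b23 ^ 2 * b30 ^ 3 * b01 ^ 3 * u * v - 2 * t1 * t2 * a1 * a3 * a0 * b23 * b30 ^ 2 * b01 ^
      3 * v - t2 ^ 2 * a2 * a3 * a0 * b23 ^ 2 * b30 ^ 2 * b01 ^ 2 * u - a3 * a0 ^ 2 * b23 ^ 2 *
      b30 ^ 4 * b01 ^ 4 * u ^ 2 - t1 * a1 * a3 * a0 ^ 2 * b23 * b30 ^ 3 * b01 ^ 4 * u - t1 ^ 2 *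
      a1 ^ 2 * a3 * a0 ^ 2 * b30 ^ 2 * b01 ^ 4) * g33n + (t2 ^ 4 * a2 * b23 * b01 * v + t2 ^ 3 *
      b23 * b30 * b01 ^ 2 * v ^ 2 + t2 ^ 2 * a0 * b23 * b30 ^ 2 * b01 ^ 3 * u * v + t2 * a1 * a3
      * a0 ^ 2 * b23 * b30 ^ 3 * b01 ^ 4 * v + t1 * t2 ^ 3 * a1 * a2 * a0 * b01 ^ 2 + t1 * t2 ^ 2
      * a1 * a0 * b30 * b01 ^ 3 * v + t1 * t2 * a1 * a0 ^ 2 * b30 ^ 2 * b01 ^ 4 * u + t1 * a1 ^ 2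
      * a3 * a0 ^ 3 * b30 ^ 3 * b01 ^ 5) * g30 + (t12 * a1 * a0 * b12 * b23 * b30 ^ 2 * b01 ^ 4 *
      u * v + t2 ^ 4 * a2 ^ 2 * b23 ^ 2 * b01 * u + 3 * t2 ^ 3 * a2 * b23 ^ 2 * b30 * b01 ^ 2 * u
      * v + 2 * t2 ^ 2 * a2 * a0 * b23 ^ 2 * b30 ^ 2 * b01 ^ 3 * u ^ 2 + 2 * t1 * t2 ^ 2 * a1 *
      a2 * a0 * b23 * b30 * b01 ^ 3 * u + 2 * t2 ^ 2 * b23 ^ 2 * b30 ^ 2 * b01 ^ 3 * u * v ^ 2 +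
      3 * t2 * a0 * b23 ^ 2 * b30 ^ 3 * b01 ^ 4 * u ^ 2 * v + 3 * t1 * t2 * a1 * a0 * b23 * b30 ^
      2 * b01 ^ 4 * u * v + a0 ^ 2 * b23 ^ 2 * b30 ^ 4 * b01 ^ 5 * u ^ 3 + 2 * t1 * a1 * a0 ^ 2 *
      b23 * b30 ^ 3 * b01 ^ 5 * u ^ 2 + t1 * t2 ^ 3 * a1 * a2 * b23 * b01 ^ 2 * v + t1 * t2 ^ 2 *
      a1 * b23 * b30 * b01 ^ 3 * v ^ 2 - t1 * a1 ^ 2 * a3 * a0 ^ 2 * b23 * b30 ^ 3 * b01 ^ 5 * v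
      + t1 ^ 2 * t2 ^ 2 * a1 ^ 2 * a2 * a0 * b01 ^ 3 - t2 ^ 3 * a1 * a2 ^ 2 * a3 * a0 * b23 ^ 2 *
      b30 * b01 ^ 2 + t1 ^ 2 * t2 * a1 ^ 2 * a0 * b30 * b01 ^ 4 * v + t1 ^ 2 * a1 ^ 2 * a0 ^ 2 *
      b30 ^ 2 * b01 ^ 5 * u - t2 * a1 * a2 * a3 * a0 ^ 2 * b23 ^ 2 * b30 ^ 3 * b01 ^ 4 * u - 2 *
      t1 * t2 * a1 ^ 2 * a2 * a3 * a0 ^ 2 * b23 * b30 ^ 2 * b01 ^ 4 - 2 * t2 ^ 2 * a1 * a2 * a3 *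
      a0 * b23 ^ 2 * b30 ^ 2 * b01 ^ 3 * v - t2 * a1 * a3 * a0 * b23 ^ 2 * b30 ^ 3 * b01 ^ 4 * v
      ^ 2 + t2 ^ 2 * t12 * a1 * a2 * b12 * b23 * b01 ^ 2 * v + t2 * t12 * a1 * b12 * b23 * b30 *
      b01 ^ 3 * v ^ 2 + t1 * t2 * t12 * a1 ^ 2 * a2 * a0 * b12 * b01 ^ 3 + t1 * t12 * a1 ^ 2 * a0
      * b12 * b30 * b01 ^ 4 * v - t12 * a1 ^ 2 * a2 * a3 * a0 ^ 2 * b12 * b23 * b30 ^ 2 * b01 ^ 4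
      + t12 ^ 2 * a1 ^ 2 * a2 * a0 * b12 ^ 2 * b01 ^ 3) * g11
  · refine (h.pow 3).mul_right_eq_zero.1 ?_
    linear_combination
      (t12 ^ 2 * t01) * g51 + (t2 * t3 * t12 * a2 * a3 * b23 ^ 2 + t1 * t3 * t12 * b23 * b01 * u
      + t2 * t0 * t12 * b23 * b01 * v + t1 * t0 * t12 * a1 * a0 * b01 ^ 2 + t12 * a1 * a2 * a3 *
      a0 * b12 * b23 ^ 2 * b30 * b01 ^ 2 - t12 * b12 * b23 ^ 2 * b30 * b01 ^ 2 * u * v) * g20 +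
      (t1 ^ 3 * t2 * a1 * a2 * a3 * b23 ^ 2 + t1 ^ 2 * t2 * a2 * a3 * b23 ^ 3 * b30 * u + t1 * t2
      * a2 * a3 ^ 2 * b23 ^ 4 * b30 ^ 2 * v + t2 * a2 ^ 2 * a3 ^ 3 * a0 * b23 ^ 5 * b30 ^ 3 + t1
      ^ 4 * a1 * b23 * b01 * u + t1 ^ 3 * b23 ^ 2 * b30 * b01 * u ^ 2 + t1 ^ 2 * a3 * b23 ^ 3 *
      b30 ^ 2 * b01 * u * v + t1 * a2 * a3 ^ 2 * a0 * b23 ^ 4 * b30 ^ 3 * b01 * u) * g33n + (-t0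
      ^ 2 * t12 ^ 2 * a0 - t0 * t12 ^ 2 * b12 * b23 * v - t12 ^ 2 * a2 * b12 ^ 2 * b23 ^ 2 * u -
      t1 ^ 2 * t0 * t12 * a1 * a0 * b01 - t1 * t0 * t12 * a0 * b23 * b30 * b01 * u - t0 * t12 *
      a3 * a0 * b23 ^ 2 * b30 ^ 2 * b01 * v - t2 * t0 * t12 * a2 * a3 * a0 * b23 ^ 2 * b30 - t1 ^
      2 * t12 * a1 * b12 * b23 * b01 * v - t1 * t12 * b12 * b23 ^ 2 * b30 * b01 * u * v - t12 *
      a3 * b12 * b23 ^ 3 * b30 ^ 2 * b01 * v ^ 2 - t2 * t12 * a2 * a3 * b12 * b23 ^ 3 * b30 * v +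
      t1 ^ 3 * t2 * a1 * b23 * b01 * v + t1 ^ 2 * t2 * b23 ^ 2 * b30 * b01 * u * v + t1 * t2 * a3
      * b23 ^ 3 * b30 ^ 2 * b01 * v ^ 2 + t1 * a1 * a2 * a3 ^ 2 * a0 ^ 2 * b23 ^ 3 * b30 ^ 3 *
      b01 ^ 2 - 2 * t1 ^ 2 * t2 * a1 * a2 * a3 * a0 * b23 ^ 2 * b30 * b01 - t1 ^ 3 * a1 * a0 *
      b23 * b30 * b01 ^ 2 * u - t1 ^ 2 * a0 * b23 ^ 2 * b30 ^ 2 * b01 ^ 2 * u ^ 2 - 2 * t1 * a3 *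
      a0 * b23 ^ 3 * b30 ^ 3 * b01 ^ 2 * u * v - 2 * t1 * t2 * a2 * a3 * a0 * b23 ^ 3 * b30 ^ 2 *
      b01 * u - t1 ^ 2 * a1 * a3 * a0 * b23 ^ 2 * b30 ^ 2 * b01 ^ 2 * v - a3 ^ 2 * a0 * b23 ^ 4 *
      b30 ^ 4 * b01 ^ 2 * v ^ 2 - t2 * a2 * a3 ^ 2 * a0 * b23 ^ 4 * b30 ^ 3 * b01 * v - t2 ^ 2 *
      a2 ^ 2 * a3 ^ 2 * a0 * b23 ^ 4 * b30 ^ 2) * g30 + (t12 * a2 * a3 * b12 * b23 ^ 4 * b30 ^ 2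
      * b01 * u * v + t1 ^ 2 * t2 ^ 2 * a1 * a2 ^ 2 * a3 * b23 ^ 3 + 2 * t1 ^ 2 * t2 * a1 * a2 *
      a3 * b23 ^ 3 * b30 * b01 * v - t1 ^ 3 * a1 ^ 2 * a2 * a3 * a0 * b23 ^ 2 * b30 * b01 ^ 2 +
      t1 * t2 ^ 2 * a2 ^ 2 * a3 * b23 ^ 4 * b30 * u + 3 * t1 * t2 * a2 * a3 * b23 ^ 4 * b30 ^ 2 *
      b01 * u * v + t2 ^ 2 * a2 ^ 2 * a3 ^ 2 * b23 ^ 5 * b30 ^ 2 * v + 2 * t2 * a2 * a3 ^ 2 * b23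
      ^ 5 * b30 ^ 3 * b01 * v ^ 2 - t1 * a1 * a2 * a3 ^ 2 * a0 * b23 ^ 4 * b30 ^ 3 * b01 ^ 2 * v
      + t1 ^ 3 * t2 * a1 * a2 * b23 ^ 2 * b01 * u + 3 * t1 ^ 3 * a1 * b23 ^ 2 * b30 * b01 ^ 2 * u
      * v + t1 ^ 2 * t2 * a2 * b23 ^ 3 * b30 * b01 * u ^ 2 + 2 * t1 ^ 2 * b23 ^ 3 * b30 ^ 2 * b01
      ^ 2 * u ^ 2 * v + 3 * t1 * a3 * b23 ^ 4 * b30 ^ 3 * b01 ^ 2 * u * v ^ 2 - t2 * a2 ^ 2 * a3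
      ^ 2 * a0 * b23 ^ 5 * b30 ^ 3 * b01 * u + t1 ^ 4 * a1 ^ 2 * b23 * b01 ^ 2 * v + 2 * t1 ^ 2 *
      a1 * a3 * b23 ^ 3 * b30 ^ 2 * b01 ^ 2 * v ^ 2 + a3 ^ 2 * b23 ^ 5 * b30 ^ 4 * b01 ^ 2 * v ^
      3 - 2 * t1 * t2 * a1 * a2 ^ 2 * a3 ^ 2 * a0 * b23 ^ 4 * b30 ^ 2 * b01 - 2 * t1 ^ 2 * a1 *
      a2 * a3 * a0 * b23 ^ 3 * b30 ^ 2 * b01 ^ 2 * u - t1 * a2 * a3 * a0 * b23 ^ 4 * b30 ^ 3 *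
      b01 ^ 2 * u ^ 2 + t1 * t2 * t12 * a1 * a2 ^ 2 * a3 * b12 * b23 ^ 3 + t2 * t12 * a2 ^ 2 * a3
      * b12 * b23 ^ 4 * b30 * u + t1 ^ 2 * t12 * a1 * a2 * b12 * b23 ^ 2 * b01 * u + t1 * t12 *
      a2 * b12 * b23 ^ 3 * b30 * b01 * u ^ 2 - t12 * a1 * a2 ^ 2 * a3 ^ 2 * a0 * b12 * b23 ^ 4 *
      b30 ^ 2 * b01 + t12 ^ 2 * a1 * a2 ^ 2 * a3 * b12 ^ 2 * b23 ^ 3) * g11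
  · refine (h.pow 1).mul_right_eq_zero.1 ?_
    linear_combination
      (t1) * g21 + (-a3 * a0 * b30 ^ 2 * b01) * g33n + (t2 ^ 2 * a2 + t2 * b30 * b01 * v + a0 *
      b30 ^ 2 * b01 ^ 2 * u) * g11
  · refine (h.pow 2).mul_right_eq_zero.1 ?_
    linear_combination
      (t1 * t12) * g51 + (-t12 * a2 * a3 * b12 * b23 ^ 2 + t1 * t2 * a2 * a3 * b23 ^ 2 + t1 ^ 2 *
      b23 * b01 * u) * g33n + (-t0 * t12 * a0 * b01 - t12 * b12 * b23 * b01 * v + t1 * t2 * b23 *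
      b01 * v - t1 * a0 * b23 * b30 * b01 ^ 2 * u - a3 * a0 * b23 ^ 2 * b30 ^ 2 * b01 ^ 2 * v -
      t2 * a2 * a3 * a0 * b23 ^ 2 * b30 * b01) * g30 + (t2 ^ 2 * a2 ^ 2 * a3 * b23 ^ 3 + 2 * t2 *
      a2 * a3 * b23 ^ 3 * b30 * b01 * v + t1 * t2 * a2 * b23 ^ 2 * b01 * u + 2 * t1 * b23 ^ 2 *
      b30 * b01 ^ 2 * u * v + t1 ^ 2 * a1 * b23 * b01 ^ 2 * v + a3 * b23 ^ 3 * b30 ^ 2 * b01 ^ 2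
      * v ^ 2 + t12 * a2 * b12 * b23 ^ 2 * b01 * u) * g11
  · refine (h.pow 2).mul_right_eq_zero.1 ?_
    linear_combination
      (t2 * t12) * g51 + (-t3 * t12 * a3 * b23 - t12 * b12 * b23 * b01 * u + t1 * t2 * b23 * b01
      * u - t2 * a3 * b23 ^ 2 * b30 * b01 * v - a3 * a0 * b23 ^ 2 * b30 ^ 2 * b01 ^ 2 * u - t1 *
      a1 * a3 * a0 * b23 * b30 * b01 ^ 2) * g33n + (-t12 * a1 * a0 * b12 * b01 ^ 2 + t2 ^ 2 * b23
      * b01 * v + t1 * t2 * a1 * a0 * b01 ^ 2) * g30 + (t2 ^ 2 * a2 * b23 ^ 2 * b01 * u + 2 * t2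
      * b23 ^ 2 * b30 * b01 ^ 2 * u * v + a0 * b23 ^ 2 * b30 ^ 2 * b01 ^ 3 * u ^ 2 + 2 * t1 * a1
      * a0 * b23 * b30 * b01 ^ 3 * u + t1 * t2 * a1 * b23 * b01 ^ 2 * v + t1 ^ 2 * a1 ^ 2 * a0 *
      b01 ^ 3 + t12 * a1 * b12 * b23 * b01 ^ 2 * v) * g11
  · refine (h.pow 1).mul_right_eq_zero.1 ?_
    linear_combination
      (t2) * g20 + (-a3 * a0 * b23 * b30 ^ 2) * g30 + (t1 ^ 2 * a1 + t1 * b23 * b30 * u + a3 *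
      b23 ^ 2 * b30 ^ 2 * v) * g11
  · refine (h.pow 2).mul_right_eq_zero.1 ?_
    linear_combination
      (t3 * t12) * g20 + (t1 ^ 3 * a1 + t1 ^ 2 * b23 * b30 * u + t1 * a3 * b23 ^ 2 * b30 ^ 2 * v
      + a2 * a3 ^ 2 * a0 * b23 ^ 3 * b30 ^ 3) * g33n + (-t0 * t12 * a0 * b30 - t12 * b12 * b23 *
      b30 * v - t1 ^ 2 * a1 * a0 * b30 * b01 - t1 * a0 * b23 * b30 ^ 2 * b01 * u - a3 * a0 * b23
      ^ 2 * b30 ^ 3 * b01 * v - t2 * a2 * a3 * a0 * b23 ^ 2 * b30 ^ 2) * g30 + (t1 ^ 2 * t2 * a1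
      * a2 * b23 + t1 ^ 2 * a1 * b23 * b30 * b01 * v + t1 * t2 * a2 * b23 ^ 2 * b30 * u + t1 *
      b23 ^ 2 * b30 ^ 2 * b01 * u * v + t2 * a2 * a3 * b23 ^ 3 * b30 ^ 2 * v + a3 * b23 ^ 3 * b30
      ^ 3 * b01 * v ^ 2 - t1 * a1 * a2 * a3 * a0 * b23 ^ 2 * b30 ^ 2 * b01 - a2 * a3 * a0 * b23 ^
      3 * b30 ^ 3 * b01 * u + t1 * t12 * a1 * a2 * b12 * b23 + t12 * a2 * b12 * b23 ^ 2 * b30 *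
      u) * g11
  · refine (h.pow 2).mul_right_eq_zero.1 ?_
    linear_combination
      (t0 * t12) * g21 + (-t3 * t12 * a3 * b30 - t12 * b12 * b30 * b01 * u - t2 ^ 2 * a2 * a3 *
      b23 * b30 - t2 * a3 * b23 * b30 ^ 2 * b01 * v - a3 * a0 * b23 * b30 ^ 3 * b01 ^ 2 * u - t1
      * a1 * a3 * a0 * b30 ^ 2 * b01 ^ 2) * g33n + (t2 ^ 3 * a2 + t2 ^ 2 * b30 * b01 * v + t2 *
      a0 * b30 ^ 2 * b01 ^ 2 * u + a1 * a3 * a0 ^ 2 * b30 ^ 3 * b01 ^ 3) * g30 + (t1 * t2 ^ 2 *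
      a1 * a2 * b01 + t2 ^ 2 * a2 * b23 * b30 * b01 * u + t1 * t2 * a1 * b30 * b01 ^ 2 * v + t2 *
      b23 * b30 ^ 2 * b01 ^ 2 * u * v + t1 * a1 * a0 * b30 ^ 2 * b01 ^ 3 * u + a0 * b23 * b30 ^ 3
      * b01 ^ 3 * u ^ 2 - t2 * a1 * a2 * a3 * a0 * b23 * b30 ^ 2 * b01 ^ 2 - a1 * a3 * a0 * b23 *
      b30 ^ 3 * b01 ^ 3 * v + t2 * t12 * a1 * a2 * b12 * b01 + t12 * a1 * b12 * b30 * b01 ^ 2 *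
      v) * g11
  · refine (h.pow 1).mul_right_eq_zero.1 ?_
    linear_combination
      (t1) * g33n + (-a0 * b30 * b01) * g30 + (t2 * a2 * b23 + b23 * b30 * b01 * v) * g11
  · refine (h.pow 1).mul_right_eq_zero.1 ?_
    linear_combination
      (-a3 * b23 * b30) * g33n + (t2) * g30 + (t1 * a1 * b01 + b23 * b30 * b01 * u) * g11
  · refine (h.pow 2).mul_right_eq_zero.1 ?_
    linear_combination
      (t12 * t01) * g21 + (t2 ^ 3 * a2 + t2 ^ 2 * b30 * b01 * v + t2 * a0 * b30 ^ 2 * b01 ^ 2 * u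
      + a1 * a3 * a0 ^ 2 * b30 ^ 3 * b01 ^ 3) * g20 + (-t0 * t12 * a3 * a0 * b30 ^ 2 - t1 * t12 *
      b12 * b30 * u) * g33n + (-t2 * t12 * b12 * b30 * v - t2 ^ 2 * a2 * a3 * a0 * b23 * b30 ^ 2
      - t2 * a3 * a0 * b23 * b30 ^ 3 * b01 * v - a3 * a0 ^ 2 * b23 * b30 ^ 4 * b01 ^ 2 * u - t1 *
      a1 * a3 * a0 ^ 2 * b30 ^ 3 * b01 ^ 2) * g30 + (-t12 * b12 * b23 * b30 ^ 2 * b01 * u * v +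
      t1 ^ 2 * t2 ^ 2 * a1 * a2 + t1 * t2 ^ 2 * a2 * b23 * b30 * u + t2 ^ 2 * a2 * a3 * b23 ^ 2 *
      b30 ^ 2 * v + t1 ^ 2 * t2 * a1 * b30 * b01 * v + t1 * t2 * b23 * b30 ^ 2 * b01 * u * v + t2
      * a3 * b23 ^ 2 * b30 ^ 3 * b01 * v ^ 2 + t1 ^ 2 * a1 * a0 * b30 ^ 2 * b01 ^ 2 * u + t1 * a0
      * b23 * b30 ^ 3 * b01 ^ 2 * u ^ 2 - a1 * a2 * a3 ^ 2 * a0 ^ 2 * b23 ^ 2 * b30 ^ 4 * b01 ^ 2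
      + t1 * t2 * t12 * a1 * a2 * b12 + a3 * a0 * b23 ^ 2 * b30 ^ 4 * b01 ^ 2 * u * v + t12 * a1
      * a2 * a3 * a0 * b12 * b23 * b30 ^ 2 * b01) * g11

/-- This and the next three lemmas drop one of the six generators when A_12 is a unit and the
relation for θ_1θ_2 holds. They serve the loci where θ_4, θ_41, θ_23 and θ_34, respectively, are
invertible, on which that relation is not among the six. -/
theorem rel3_zero_one_of_isUnit_AE (x : Var → R) (h : IsUnit (x (.AE 1)))
    (g11 : rel1 x 1 2 3 0 = 0) (g40 : rel4 x 0 1 2 3 = 0) (g41 : rel4 x 1 2 3 0 = 0) :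
    rel3 x 0 1 2 3 = 0 := by
  obtain ⟨⟨e1, e2, e3, e4, e5, e6, e7, e8⟩, p0, p1, p2, p3⟩ := edge_par_values
  simp only [rel1, rel3, rel4, e1, e2, e3, e4, e5, e6, e7, e8, p0, p1, p2, p3] at *
  generalize x (.θ 1) = t1, x (.θ 2) = t2, x (.θ 3) = t3, x (.θ 0) = t0, x (.θE 1) = t12,
  x (.θE 2) = t23, x (.θE 3) = t30, x (.θE 0) = t01, x (.A 1) = a1, x (.A 2) = a2, x (.A 3) = a3,
  x (.A 0) = a0, x (.AE 1) = b12, x (.AE 2) = b23, x (.AE 3) = b30, x (.AE 0) = b01,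
  x (.lam 1) = u, x (.lam 0) = v at *
  refine (h.pow 1).mul_right_eq_zero.1 ?_
  linear_combination
    (-t0) * g11 + (t1) * g40 + (a3 * b23 * b30) * g41

theorem rel2_zero_one_of_isUnit_AE (x : Var → R) (h : IsUnit (x (.AE 1)))
    (g11 : rel1 x 1 2 3 0 = 0) (g10 : rel1 x 0 1 2 3 = 0) (g32n : rel3 x 2 1 0 3 = 0) :
    rel2 x 0 1 2 3 = 0 := by
  obtain ⟨⟨e1, e2, e3, e4, e5, e6, e7, e8⟩, p0, p1, p2, p3⟩ := edge_par_values
  simp only [rel1, rel2, rel3, e1, e2, e3, e4, e5, e6, e7, e8, p0, p1, p2, p3] at *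
  generalize x (.θ 1) = t1, x (.θ 2) = t2, x (.θ 3) = t3, x (.θ 0) = t0, x (.θE 1) = t12,
  x (.θE 2) = t23, x (.θE 3) = t30, x (.θE 0) = t01, x (.A 1) = a1, x (.A 2) = a2, x (.A 3) = a3,
  x (.A 0) = a0, x (.AE 1) = b12, x (.AE 2) = b23, x (.AE 3) = b30, x (.AE 0) = b01,
  x (.lam 1) = u, x (.lam 0) = v at *
  refine (h.pow 1).mul_right_eq_zero.1 ?_
  linear_combination
    (-t01) * g11 + (a3 * a0 * b23 * b30 ^ 2) * g10 + (t1) * g32n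

theorem rel2_one_two_of_isUnit_AE (x : Var → R) (h : IsUnit (x (.AE 1)))
    (g11 : rel1 x 1 2 3 0 = 0) (g12 : rel1 x 2 3 0 1 = 0) (g31 : rel3 x 1 2 3 0 = 0) :
    rel2 x 1 2 3 0 = 0 := by
  obtain ⟨⟨e1, e2, e3, e4, e5, e6, e7, e8⟩, p0, p1, p2, p3⟩ := edge_par_values
  simp only [rel1, rel2, rel3, e1, e2, e3, e4, e5, e6, e7, e8, p0, p1, p2, p3] at *
  generalize x (.θ 1) = t1, x (.θ 2) = t2, x (.θ 3) = t3, x (.θ 0) = t0, x (.θE 1) = t12,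
  x (.θE 2) = t23, x (.θE 3) = t30, x (.θE 0) = t01, x (.A 1) = a1, x (.A 2) = a2, x (.A 3) = a3,
  x (.A 0) = a0, x (.AE 1) = b12, x (.AE 2) = b23, x (.AE 3) = b30, x (.AE 0) = b01,
  x (.lam 1) = u, x (.lam 0) = v at *
  refine (h.pow 1).mul_right_eq_zero.1 ?_
  linear_combination
    (-t23) * g11 + (a3 * a0 * b30 ^ 2 * b01) * g12 + (t2) * g31

theorem rel5_three_zero_of_isUnit_AE (x : Var → R) (h : IsUnit (x (.AE 1)))
    (g11 : rel1 x 1 2 3 0 = 0) (g31n : rel3 x 1 0 3 2 = 0) (g13 : rel1 x 3 0 1 2 = 0)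
    (g42 : rel4 x 2 3 0 1 = 0) (g41 : rel4 x 1 2 3 0 = 0) :
    rel5 x 3 0 1 2 = 0 := by
  obtain ⟨⟨e1, e2, e3, e4, e5, e6, e7, e8⟩, p0, p1, p2, p3⟩ := edge_par_values
  simp only [rel1, rel3, rel4, rel5, e1, e2, e3, e4, e5, e6, e7, e8, p0, p1, p2, p3] at *
  generalize x (.θ 1) = t1, x (.θ 2) = t2, x (.θ 3) = t3, x (.θ 0) = t0, x (.θE 1) = t12,
  x (.θE 2) = t23, x (.θE 3) = t30, x (.θE 0) = t01, x (.A 1) = a1, x (.A 2) = a2, x (.A 3) = a3,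
  x (.A 0) = a0, x (.AE 1) = b12, x (.AE 2) = b23, x (.AE 3) = b30, x (.AE 0) = b01,
  x (.lam 1) = u, x (.lam 0) = v at *
  refine (h.pow 1).mul_right_eq_zero.1 ?_
  linear_combination
    (-t30) * g11 + (t2) * g31n + (a3 * a0 * b23 * b30 * b01) * g13 + (t0 * a0 * b01) * g42 +
    (-b12 * b23 * b01 * u) * g41

/-- This supplies the hypothesis on θ_1θ_3 in `rel3_zero_one_of_isUnit_AE` where θ_4 is invertible.
-/
theorem rel4_one_of_isUnit_θ_zero (x : Var → R) (h : IsUnit (x (.θ 0)))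
    (g10 : rel1 x 0 1 2 3 = 0) (g13 : rel1 x 3 0 1 2 = 0) (g40 : rel4 x 0 1 2 3 = 0)
    (g23 : rel2 x 3 0 1 2 = 0) :
    rel4 x 1 2 3 0 = 0 := by
  obtain ⟨⟨e1, e2, e3, e4, e5, e6, e7, e8⟩, p0, p1, p2, p3⟩ := edge_par_values
  simp only [rel1, rel2, rel4, e1, e2, e3, e4, e5, e6, e7, e8, p0, p1, p2, p3] at *
  generalize x (.θ 1) = t1, x (.θ 2) = t2, x (.θ 3) = t3, x (.θ 0) = t0, x (.θE 1) = t12,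
  x (.θE 2) = t23, x (.θE 3) = t30, x (.θE 0) = t01, x (.A 1) = a1, x (.A 2) = a2, x (.A 3) = a3,
  x (.A 0) = a0, x (.AE 1) = b12, x (.AE 2) = b23, x (.AE 3) = b30, x (.AE 0) = b01,
  x (.lam 1) = u, x (.lam 0) = v at *
  refine (h.pow 2).mul_right_eq_zero.1 ?_
  linear_combination
    (t3 * t0 - a1 * a2 * b12 ^ 2 * b23 * b01) * g10 + (t01 * b01) * g13 + (-t0 * a2 * b12 * b23)
    * g40 + (b30 * b01) * g23

/-- With its companion for θ_2θ_4, this supplies the two diagonal relations used by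
`rel5_three_zero_of_isUnit_AE`. -/
theorem rel4_one_of_isUnit_θE_three (x : Var → R) (h : IsUnit (x (.θE 3)))
    (g31n : rel3 x 1 0 3 2 = 0) (g32 : rel3 x 2 3 0 1 = 0) (g13 : rel1 x 3 0 1 2 = 0) :
    rel4 x 1 2 3 0 = 0 := by
  obtain ⟨⟨e1, e2, e3, e4, e5, e6, e7, e8⟩, p0, p1, p2, p3⟩ := edge_par_values
  simp only [rel1, rel3, rel4, e1, e2, e3, e4, e5, e6, e7, e8, p0, p1, p2, p3] at *
  generalize x (.θ 1) = t1, x (.θ 2) = t2, x (.θ 3) = t3, x (.θ 0) = t0, x (.θE 1) = t12,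
  x (.θE 2) = t23, x (.θE 3) = t30, x (.θE 0) = t01, x (.A 1) = a1, x (.A 2) = a2, x (.A 3) = a3,
  x (.A 0) = a0, x (.AE 1) = b12, x (.AE 2) = b23, x (.AE 3) = b30, x (.AE 0) = b01,
  x (.lam 1) = u, x (.lam 0) = v at *
  refine (h.pow 1).mul_right_eq_zero.1 ?_
  linear_combination
    (t3) * g31n + (-a2 * b12 * b23) * g32 + (t0 * a0 * b01 + b12 * b23 * b01 * v) * g13

theorem rel4_two_of_isUnit_θE_three (x : Var → R) (h : IsUnit (x (.θE 3)))
    (g31n : rel3 x 1 0 3 2 = 0) (g32 : rel3 x 2 3 0 1 = 0) (g13 : rel1 x 3 0 1 2 = 0) :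
    rel4 x 2 3 0 1 = 0 := by
  obtain ⟨⟨e1, e2, e3, e4, e5, e6, e7, e8⟩, p0, p1, p2, p3⟩ := edge_par_values
  simp only [rel1, rel3, rel4, e1, e2, e3, e4, e5, e6, e7, e8, p0, p1, p2, p3] at *
  generalize x (.θ 1) = t1, x (.θ 2) = t2, x (.θ 3) = t3, x (.θ 0) = t0, x (.θE 1) = t12,
  x (.θE 2) = t23, x (.θE 3) = t30, x (.θE 0) = t01, x (.A 1) = a1, x (.A 2) = a2, x (.A 3) = a3,
  x (.A 0) = a0, x (.AE 1) = b12, x (.AE 2) = b23, x (.AE 3) = b30, x (.AE 0) = b01,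
  x (.lam 1) = u, x (.lam 0) = v at *
  refine (h.pow 1).mul_right_eq_zero.1 ?_
  linear_combination
    (-a1 * b12 * b01) * g31n + (t0) * g32 + (t3 * a3 * b23 + b12 * b23 * b01 * u) * g13

end Relations

end G2Format

/-! ### Complete intersection charts: six or five generators. -/

namespace G2Format

section Charts

variable {R : Type*} [CommRing R]

/-- Rotation by i + 3 = i - 1 carries the label 1 to i, moving the identities at label 1 to any
label. -/
theorem add_three_values : ∀ i : ZMod 4,
    1 + (i + 3) = i ∧ 2 + (i + 3) = i + 1 ∧ 3 + (i + 3) = i + 2 ∧ 0 + (i + 3) = i + 3 := by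
  decide

theorem rel_rotate (x : Var → R) (r : ZMod 4) {i j k l : ZMod 4} (hq : (i, j, k, l) ∈ dihedral) :
    rel1 (x ∘ Var.rotate r) i j k l = rel1 x (i + r) (j + r) (k + r) (l + r) ∧
    rel2 (x ∘ Var.rotate r) i j k l = rel2 x (i + r) (j + r) (k + r) (l + r) ∧
    rel3 (x ∘ Var.rotate r) i j k l = rel3 x (i + r) (j + r) (k + r) (l + r) ∧
    rel4 (x ∘ Var.rotate r) i j k l = rel4 x (i + r) (j + r) (k + r) (l + r) ∧
    rel5 (x ∘ Var.rotate r) i j k l = rel5 x (i + r) (j + r) (k + r) (l + r) :=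
  rel_map x (edge_add r) (par_add r) hq

/-- Where `θ_i` is invertible, six relations imply all others. -/
theorem relations_eq_zero_of_isUnit_θ (x : Var → R) (i : ZMod 4) (h : IsUnit (x (.θ i)))
    (g3 : rel3 x i (i + 1) (i + 2) (i + 3) = 0) (g3' : rel3 x i (i + 3) (i + 2) (i + 1) = 0)
    (g4 : rel4 x i (i + 1) (i + 2) (i + 3) = 0) (g1 : rel1 x i (i + 1) (i + 2) (i + 3) = 0)
    (g1' : rel1 x (i + 3) i (i + 1) (i + 2) = 0) (g2 : rel2 x (i + 3) i (i + 1) (i + 2) = 0) :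
    ∀ f ∈ relations x, f = 0 := by
  obtain ⟨h1, h2, h3, h0⟩ := add_three_values i
  obtain ⟨a1, -, a3, a4, -⟩ := rel_rotate x (i + 3) (show (1, 2, 3, 0) ∈ dihedral by decide)
  obtain ⟨b1, b2, -⟩ := rel_rotate x (i + 3) (show (0, 1, 2, 3) ∈ dihedral by decide)
  obtain ⟨-, -, c3, -⟩ := rel_rotate x (i + 3) (show (1, 0, 3, 2) ∈ dihedral by decide)
  rw [h1, h2, h3, h0] at a1 a3 a4 b1 b2 c3
  rw [← relations_comp_rotate x (i + 3)]
  refine relations_eq_zero_of_isUnit_θ_one _ ?_ (a3.trans g3) (c3.trans g3') (a4.trans g4)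
    (a1.trans g1) (b1.trans g1') (b2.trans g2)
  rwa [Function.comp_apply, Var.rotate, Var.map, h1]

/-- Where `θ_{i,i+1}` is invertible, six relations imply all others. -/
theorem relations_eq_zero_of_isUnit_θE (x : Var → R) (i : ZMod 4) (h : IsUnit (x (.θE i)))
    (g5 : rel5 x i (i + 1) (i + 2) (i + 3) = 0) (g2 : rel2 x i (i + 1) (i + 2) (i + 3) = 0)
    (g2' : rel2 x (i + 3) i (i + 1) (i + 2) = 0) (g3 : rel3 x (i + 2) (i + 1) i (i + 3) = 0)
    (g3' : rel3 x (i + 3) i (i + 1) (i + 2) = 0) (g1 : rel1 x i (i + 1) (i + 2) (i + 3) = 0) :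
    ∀ f ∈ relations x, f = 0 := by
  obtain ⟨h1, h2, h3, h0⟩ := add_three_values i
  obtain ⟨a1, a2, -, -, a5⟩ := rel_rotate x (i + 3) (show (1, 2, 3, 0) ∈ dihedral by decide)
  obtain ⟨-, b2, b3, -⟩ := rel_rotate x (i + 3) (show (0, 1, 2, 3) ∈ dihedral by decide)
  obtain ⟨-, -, c3, -⟩ := rel_rotate x (i + 3) (show (3, 2, 1, 0) ∈ dihedral by decide)
  rw [h1, h2, h3, h0] at a1 a2 a5 b2 b3 c3
  rw [← relations_comp_rotate x (i + 3)]
  refine relations_eq_zero_of_isUnit_θE_one _ ?_ (a5.trans g5) (a2.trans g2) (b2.trans g2')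
    (c3.trans g3) (b3.trans g3') (a1.trans g1)
  rwa [Function.comp_apply, Var.rotate, Var.map, h1]

theorem rel_mem_relations (x : Var → R) {i j k l : ZMod 4} (hq : (i, j, k, l) ∈ dihedral) :
    rel1 x i j k l ∈ relations x ∧ rel2 x i j k l ∈ relations x ∧ rel3 x i j k l ∈ relations x ∧
      rel4 x i j k l ∈ relations x ∧ rel5 x i j k l ∈ relations x := by
  simp only [mem_relations_iff]
  refine ⟨?_, ?_, ?_, ?_, ?_⟩ <;> exact ⟨i, j, k, l, hq, by simp⟩

/-- Some of the relations generate the same ideal as all of them if their vanishing in any algebra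
implies that of the others. -/
theorem span_relations_eq_span_range {n : ℕ} (x : Var → R) (g : Fin n → R)
    (hg : ∀ k, g k ∈ relations x)
    (H : ∀ f : R →+* R ⧸ Ideal.span (Set.range g), (∀ k, f (g k) = 0) →
      ∀ r ∈ relations (f ∘ x), r = 0) :
    Ideal.span (relations x) = Ideal.span (Set.range g) := by
  refine le_antisymm (Ideal.span_le.2 fun r hr => ?_) (Ideal.span_mono ?_)
  -- The universal test is the quotient map itself: vanishing there is membership in the span.
  · refine Ideal.Quotient.eq_zero_iff_mem.1 (H (Ideal.Quotient.mk _) (fun k => ?_) _ ?_)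
    · exact Ideal.Quotient.eq_zero_iff_mem.2 (Ideal.subset_span ⟨k, rfl⟩)
    · rw [relations_comp]
      exact ⟨r, hr, rfl⟩
  · rintro _ ⟨k, rfl⟩
    exact hg k

theorem dihedral_values : ∀ i : ZMod 4, (i, i + 1, i + 2, i + 3) ∈ dihedral ∧
    (i, i + 3, i + 2, i + 1) ∈ dihedral ∧ (i + 3, i, i + 1, i + 2) ∈ dihedral ∧
    (i + 2, i + 1, i, i + 3) ∈ dihedral := by
  decide

/-- If `θ_i` is invertible, then six relations generate the ideal. -/
theorem exists_six_generators_of_isUnit_θ (x : Var → R) (i : ZMod 4) (h : IsUnit (x (.θ i))) :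
    ∃ g : Fin 6 → R, Ideal.span (relations x) = Ideal.span (Set.range g) := by
  obtain ⟨d1, d2, d3, -⟩ := dihedral_values i
  obtain ⟨m1, -, m3, m4, -⟩ := rel_mem_relations x d1
  obtain ⟨-, -, n3, -⟩ := rel_mem_relations x d2
  obtain ⟨o1, o2, -⟩ := rel_mem_relations x d3
  refine ⟨![rel3 x i (i + 1) (i + 2) (i + 3), rel3 x i (i + 3) (i + 2) (i + 1),
    rel4 x i (i + 1) (i + 2) (i + 3), rel1 x i (i + 1) (i + 2) (i + 3),
    rel1 x (i + 3) i (i + 1) (i + 2), rel2 x (i + 3) i (i + 1) (i + 2)],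
    span_relations_eq_span_range x _ (fun k => by fin_cases k <;> assumption) fun f hf => ?_⟩
  simp only [Fin.forall_fin_succ, Matrix.cons_val_zero, Matrix.cons_val_succ, map_rel] at hf
  obtain ⟨g3, g3', g4, g1, g1', g2, -⟩ := hf
  exact relations_eq_zero_of_isUnit_θ _ i (h.map f) g3 g3' g4 g1 g1' g2

/-- If `θ_{i,i+1}` is invertible, then six relations generate the ideal. -/
theorem exists_six_generators_of_isUnit_θE (x : Var → R) (i : ZMod 4)
    (h : IsUnit (x (.θE i))) :
    ∃ g : Fin 6 → R, Ideal.span (relations x) = Ideal.span (Set.range g) := by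
  obtain ⟨d1, -, d3, d4⟩ := dihedral_values i
  obtain ⟨m1, m2, -, -, m5⟩ := rel_mem_relations x d1
  obtain ⟨-, n2, n3, -⟩ := rel_mem_relations x d3
  obtain ⟨-, -, o3, -⟩ := rel_mem_relations x d4
  refine ⟨![rel5 x i (i + 1) (i + 2) (i + 3), rel2 x i (i + 1) (i + 2) (i + 3),
    rel2 x (i + 3) i (i + 1) (i + 2), rel3 x (i + 2) (i + 1) i (i + 3),
    rel3 x (i + 3) i (i + 1) (i + 2), rel1 x i (i + 1) (i + 2) (i + 3)],
    span_relations_eq_span_range x _ (fun k => by fin_cases k <;> assumption) fun f hf => ?_⟩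
  simp only [Fin.forall_fin_succ, Matrix.cons_val_zero, Matrix.cons_val_succ, map_rel] at hf
  obtain ⟨g5, g2, g2', g3, g3', g1, -⟩ := hf
  exact relations_eq_zero_of_isUnit_θE _ i (h.map f) g5 g2 g2' g3 g3' g1

/-- If `A_{12}` and one of `θ_1`, `θ_2`, `θ_4`, `θ_{23}`, `θ_{34}`, `θ_{41}` are invertible and
`θ_{12}` is eliminated, then five relations generate the ideal. -/
theorem exists_five_generators_of_isUnit (x : Var → R) (hA : IsUnit (x (.AE 1)))
    (h12 : rel1 x 1 2 3 0 = 0)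
    (h : IsUnit (x (.θ 1)) ∨ IsUnit (x (.θ 2)) ∨ IsUnit (x (.θ 0)) ∨ IsUnit (x (.θE 2)) ∨
      IsUnit (x (.θE 3)) ∨ IsUnit (x (.θE 0))) :
    ∃ g : Fin 5 → R, Ideal.span (relations x) = Ideal.span (Set.range g) := by
  -- This relation is already zero, so it is available in every quotient without being a generator.
  -- For θ_1 and θ_2 it is one of the six, leaving five; in the other cases a further relation is
  -- deduced from it.
  have h12' (n : ℕ) (g : Fin n → R) (f : R →+* R ⧸ Ideal.span (Set.range g)) :
      rel1 (f ∘ x) 1 2 3 0 = 0 := by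
    rw [← (map_rel f x 1 2 3 0).1, h12, map_zero]
  obtain ⟨a1, a2, a3, a4, a5⟩ := rel_mem_relations x (show (1, 2, 3, 0) ∈ dihedral by decide)
  obtain ⟨b1, b2, b3, b4, b5⟩ := rel_mem_relations x (show (2, 3, 0, 1) ∈ dihedral by decide)
  obtain ⟨c1, c2, c3, c4, c5⟩ := rel_mem_relations x (show (3, 0, 1, 2) ∈ dihedral by decide)
  obtain ⟨d1, d2, d3, d4, d5⟩ := rel_mem_relations x (show (0, 1, 2, 3) ∈ dihedral by decide)
  obtain ⟨-, -, a3', -⟩ := rel_mem_relations x (show (1, 0, 3, 2) ∈ dihedral by decide)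
  obtain ⟨-, -, b3', -⟩ := rel_mem_relations x (show (2, 1, 0, 3) ∈ dihedral by decide)
  obtain ⟨-, -, c3', -⟩ := rel_mem_relations x (show (3, 2, 1, 0) ∈ dihedral by decide)
  obtain ⟨-, -, d3', -⟩ := rel_mem_relations x (show (0, 3, 2, 1) ∈ dihedral by decide)
  rcases h with h | h | h | h | h | h
  · refine ⟨![rel3 x 1 2 3 0, rel3 x 1 0 3 2, rel4 x 1 2 3 0, rel1 x 0 1 2 3, rel2 x 0 1 2 3],
      span_relations_eq_span_range x _ (fun k => by fin_cases k <;> assumption) fun f hf => ?_⟩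
    have e12 := h12' _ _ f
    simp only [Fin.forall_fin_succ, Matrix.cons_val_zero, Matrix.cons_val_succ, map_rel] at hf
    obtain ⟨g3, g3', g4, g1', g2, -⟩ := hf
    exact relations_eq_zero_of_isUnit_θ _ 1 (h.map f) g3 g3' g4 e12 g1' g2
  · refine ⟨![rel3 x 2 3 0 1, rel3 x 2 1 0 3, rel4 x 2 3 0 1, rel1 x 2 3 0 1, rel2 x 1 2 3 0],
      span_relations_eq_span_range x _ (fun k => by fin_cases k <;> assumption) fun f hf => ?_⟩
    have e12 := h12' _ _ f
    simp only [Fin.forall_fin_succ, Matrix.cons_val_zero, Matrix.cons_val_succ, map_rel] at hf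
    obtain ⟨g3, g3', g4, g1, g2, -⟩ := hf
    exact relations_eq_zero_of_isUnit_θ _ 2 (h.map f) g3 g3' g4 g1 e12 g2
  · refine ⟨![rel3 x 0 3 2 1, rel4 x 0 1 2 3, rel1 x 0 1 2 3, rel1 x 3 0 1 2, rel2 x 3 0 1 2],
      span_relations_eq_span_range x _ (fun k => by fin_cases k <;> assumption) fun f hf => ?_⟩
    have e12 := h12' _ _ f
    simp only [Fin.forall_fin_succ, Matrix.cons_val_zero, Matrix.cons_val_succ, map_rel] at hf
    obtain ⟨g3', g4, g1, g1', g2, -⟩ := hf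
    have g41 := rel4_one_of_isUnit_θ_zero (f ∘ x) (h.map f) g1 g1' g4 g2
    have g3 := rel3_zero_one_of_isUnit_AE (f ∘ x) (hA.map f) e12 g4 g41
    exact relations_eq_zero_of_isUnit_θ _ 0 (h.map f) g3 g3' g4 g1 g1' g2
  · refine ⟨![rel5 x 2 3 0 1, rel2 x 2 3 0 1, rel3 x 0 3 2 1, rel3 x 1 2 3 0, rel1 x 2 3 0 1],
      span_relations_eq_span_range x _ (fun k => by fin_cases k <;> assumption) fun f hf => ?_⟩
    have e12 := h12' _ _ f
    simp only [Fin.forall_fin_succ, Matrix.cons_val_zero, Matrix.cons_val_succ, map_rel] at hf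
    obtain ⟨g5, g2, g3, g3', g1, -⟩ := hf
    have g2' := rel2_one_two_of_isUnit_AE (f ∘ x) (hA.map f) e12 g1 g3'
    exact relations_eq_zero_of_isUnit_θE _ 2 (h.map f) g5 g2 g2' g3 g3' g1
  · refine ⟨![rel2 x 3 0 1 2, rel2 x 2 3 0 1, rel3 x 1 0 3 2, rel3 x 2 3 0 1, rel1 x 3 0 1 2],
      span_relations_eq_span_range x _ (fun k => by fin_cases k <;> assumption) fun f hf => ?_⟩
    have e12 := h12' _ _ f
    simp only [Fin.forall_fin_succ, Matrix.cons_val_zero, Matrix.cons_val_succ, map_rel] at hf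
    obtain ⟨g2, g2', g3, g3', g1, -⟩ := hf
    have g41 := rel4_one_of_isUnit_θE_three (f ∘ x) (h.map f) g3 g3' g1
    have g42 := rel4_two_of_isUnit_θE_three (f ∘ x) (h.map f) g3 g3' g1
    have g5 := rel5_three_zero_of_isUnit_AE (f ∘ x) (hA.map f) e12 g3 g1 g42 g41
    exact relations_eq_zero_of_isUnit_θE _ 3 (h.map f) g5 g2 g2' g3 g3' g1
  · refine ⟨![rel5 x 0 1 2 3, rel2 x 3 0 1 2, rel3 x 2 1 0 3, rel3 x 3 0 1 2, rel1 x 0 1 2 3],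
      span_relations_eq_span_range x _ (fun k => by fin_cases k <;> assumption) fun f hf => ?_⟩
    have e12 := h12' _ _ f
    simp only [Fin.forall_fin_succ, Matrix.cons_val_zero, Matrix.cons_val_succ, map_rel] at hf
    obtain ⟨g5, g2', g3, g3', g1, -⟩ := hf
    have g2 := rel2_zero_one_of_isUnit_AE (f ∘ x) (hA.map f) e12 g1 g3
    exact relations_eq_zero_of_isUnit_θE _ 0 (h.map f) g5 g2 g2' g3 g3' g1

end Charts

end G2Format

/-! ### The singular point off the vertex. -/

namespace G2Format

open MvPolynomial

section Main

variable {m : ℕ}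

theorem pullbackIdeal_eq_span (φ : Var → MvPolynomial (Fin m) ℂ) :
    pullbackIdeal φ = Ideal.span (relations φ) := by
  rw [pullbackIdeal, clusterIdeal, Ideal.map_span]
  congr 1
  have h := relations_comp ((aeval φ : MvPolynomial Var ℂ →ₐ[ℂ] MvPolynomial (Fin m) ℂ) :
    MvPolynomial Var ℂ →+* MvPolynomial (Fin m) ℂ) X
  have hx : (((aeval φ : MvPolynomial Var ℂ →ₐ[ℂ] MvPolynomial (Fin m) ℂ) :
      MvPolynomial Var ℂ →+* MvPolynomial (Fin m) ℂ) ∘ X) = φ := funext fun v => by simp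
  rw [hx] at h
  exact h.symm

/-- Where `A_3` vanishes identically and `A_{12}` is a nonzero constant, the differentials of the
relations are spanned by five of them along
`θ_1 = θ_2 = θ_4 = θ_{12} = θ_{23} = θ_{34} = θ_{41} = A_{41} = λ_{13} = 0`. -/
theorem grad_relations_mem_span {x : Var → MvPolynomial (Fin m) ℂ} {p : Fin m → ℂ} {b : ℂ}
    (hb : b ≠ 0) (hA : x (.AE 1) = C b) (h3 : x (.A 3) = 0)
    (t1 : eval p (x (.θ 1)) = 0) (t2 : eval p (x (.θ 2)) = 0) (t0 : eval p (x (.θ 0)) = 0)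
    (t12 : eval p (x (.θE 1)) = 0) (t23 : eval p (x (.θE 2)) = 0)
    (t30 : eval p (x (.θE 3)) = 0) (t01 : eval p (x (.θE 0)) = 0)
    (b01 : eval p (x (.AE 0)) = 0) (u : eval p (x (.lam 1)) = 0) :
    ∀ r ∈ relations x, eval p r = 0 ∧ grad p r ∈ Submodule.span ℂ
      {grad p (rel1 x 1 2 3 0), grad p (rel1 x 2 3 0 1), grad p (rel1 x 3 0 1 2),
        grad p (rel3 x 3 0 1 2), grad p (rel4 x 1 2 3 0)} := by
  obtain ⟨⟨e1, e2, e3, e4, e5, e6, e7, e8⟩, p0, p1, p2, p3⟩ := edge_par_values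
  -- Outside the six relations listed, every monomial either contains A_3 or has at least two
  -- factors vanishing at `p`, so its differential is zero.
  have key : ∀ r ∈ relations x, eval p r = 0 ∧ (grad p r = 0 ∨ r = rel1 x 1 2 3 0 ∨
      r = rel1 x 2 3 0 1 ∨ r = rel1 x 3 0 1 2 ∨ r = rel3 x 3 0 1 2 ∨ r = rel4 x 1 2 3 0 ∨
      r = rel3 x 3 2 1 0) := by
    refine forall_relations x _ ?_ ?_ ?_ ?_ ?_ ?_ ?_ ?_ ?_ ?_ ?_ ?_ ?_ ?_ ?_ ?_ ?_ ?_ ?_ ?_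
    all_goals
      refine ⟨by simp [rel1, rel2, rel3, rel4, rel5, e1, e2, e3, e4, e5, e6, e7, e8, p0, p1, p2,
        p3, h3, t1, t2, t0, t12, t23, t30, t01, b01, u], ?_⟩
    all_goals first
      | exact Or.inr (by simp)
      | exact Or.inl <| by
          simp [rel1, rel2, rel3, rel4, rel5, e1, e2, e3, e4, e5, e6, e7, e8, p0, p1, p2, p3, h3,
            hA, t1, t2, t0, t12, t23, t30, t01, b01, u, grad_mul, grad_pow, grad_C]
  -- At `p` the relation for θ_3θ_12 has differential θ_3 dθ_12, and that for θ_1θ_2 has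
  -- differential -b dθ_12. This proportionality brings the rank bound from 6 down to 5.
  have h3210 : grad p (rel3 x 3 2 1 0) =
      -(eval p (x (.θ 3)) * b⁻¹) • grad p (rel1 x 1 2 3 0) := by
    simp [rel1, rel3, e1, e2, e3, e4, e5, e6, e7, e8, p2, p3, h3, hA, t1, t2, t12, b01, u,
      grad_mul, grad_pow, grad_C, smul_smul, hb]
  intro r hr
  obtain ⟨h0, h⟩ := key r hr
  refine ⟨h0, ?_⟩
  rcases h with h | rfl | rfl | rfl | rfl | rfl | rfl
  · rw [h]
    exact Submodule.zero_mem _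
  on_goal 6 =>
    rw [h3210]
    refine Submodule.smul_mem _ _ ?_
  all_goals exact Submodule.subset_span (by simp)

theorem finrank_span_insert_le (v : Fin m → ℂ) (S : Set (Fin m → ℂ)) :
    Module.finrank ℂ (Submodule.span ℂ (insert v S)) ≤
      Module.finrank ℂ (Submodule.span ℂ S) + 1 := by
  rw [Submodule.span_insert, add_comm]
  exact (Submodule.finrank_add_le_finrank_add_finrank _ _).trans
    (Nat.add_le_add_right ((finrank_span_le_card {v}).trans (by simp)) _)

theorem finrank_span_four_le (v₁ v₂ v₃ v₄ : Fin m → ℂ) :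
    Module.finrank ℂ (Submodule.span ℂ {v₁, v₂, v₃, v₄}) ≤ 4 := by
  have h (v : Fin m → ℂ) : Module.finrank ℂ (Submodule.span ℂ {v}) ≤ 1 :=
    (finrank_span_le_card {v}).trans (by simp)
  have h1 := finrank_span_insert_le v₁ {v₂, v₃, v₄}
  have h2 := finrank_span_insert_le v₂ {v₃, v₄}
  have h3 := finrank_span_insert_le v₃ {v₄}
  have h4 := h v₄
  omega

/-- A coordinate of degree zero pulls back to a nonzero constant. -/
theorem IsAdmissibleAt.exists_eq_C {ρ ρE : ZMod 4 → ℤ} {a : Fin m → ℤ} (ha : ∀ k, 0 < a k)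
    {φ : Var → MvPolynomial (Fin m) ℂ} {v : Var} (h : IsAdmissibleAt ρ ρE a φ v)
    (h0 : deg ρ ρE v = 0) : ∃ c ≠ 0, φ v = C c := by
  obtain ⟨h1, h2⟩ := h
  rw [h0] at h1
  obtain ⟨c, hc⟩ := eq_C_of_isWeightedHomogeneous_zero ha h1
  refine ⟨c, ?_, hc⟩
  rintro rfl
  exact h2 h0 (by rw [hc, C_0])

theorem isUnit_C_of_ne_zero {c : ℂ} (hc : c ≠ 0) : IsUnit (C c : MvPolynomial (Fin m) ℂ) :=
  (IsUnit.mk0 c hc).map C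

/-- Otherwise nine functions on 𝔸¹⁰ vanish at the vertex, hence at some other point, where the rank
is at most 5. -/
theorem deg_lam_one_eq_zero_of_isG2Cone {ρ ρE : ZMod 4 → ℤ} {a : Fin 10 → ℤ}
    {φ : Var → MvPolynomial (Fin 10) ℂ} (h : IsG2Cone ρ ρE a φ) (h12 : deg ρ ρE (.AE 1) = 0)
    (h41 : 0 < deg ρ ρE (.AE 0)) (h3 : deg ρ ρE (.A 3) < 0) : deg ρ ρE (.lam 1) = 0 := by
  by_contra hu
  have hvan (v : Var) (hv : deg ρ ρE v ≠ 0) : eval 0 (φ v) = 0 :=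
    eval_zero_of_isWeightedHomogeneous hv (h.admissible v).1
  -- Six generators in codimension 6 would make the cone a complete intersection.
  have hnot (g : Fin 6 → MvPolynomial (Fin 10) ℂ) :
      Ideal.span (relations φ) ≠ Ideal.span (Set.range g) := fun hg =>
    h.not_ci ⟨6, g, by rw [pullbackIdeal_eq_span, hg], h.codim⟩
  have hθ (i : ZMod 4) : deg ρ ρE (.θ i) ≠ 0 := fun h0 => by
    obtain ⟨c, hc, hφ⟩ := (h.admissible _).exists_eq_C h.weight_pos h0
    obtain ⟨g, hg⟩ := exists_six_generators_of_isUnit_θ φ i (hφ ▸ isUnit_C_of_ne_zero hc)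
    exact hnot g hg
  have hθE (i : ZMod 4) : deg ρ ρE (.θE i) ≠ 0 := fun h0 => by
    obtain ⟨c, hc, hφ⟩ := (h.admissible _).exists_eq_C h.weight_pos h0
    obtain ⟨g, hg⟩ := exists_six_generators_of_isUnit_θE φ i (hφ ▸ isUnit_C_of_ne_zero hc)
    exact hnot g hg
  obtain ⟨b, hb, hA⟩ := (h.admissible _).exists_eq_C h.weight_pos h12
  have hA3 : φ (.A 3) = 0 :=
    eq_zero_of_isWeightedHomogeneous_neg h.weight_pos h3 (h.admissible _).1
  -- A_3 is identically zero and so costs no equation; θ_3 and λ_24 need not vanish at `p`. That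
  -- keeps the number of equations at nine, one below the dimension.
  obtain ⟨p, hp, hpg⟩ := exists_ne_zero_common_zero (n := 9) (m := 10) (by norm_num)
    ![φ (.θ 1), φ (.θ 2), φ (.θ 0), φ (.θE 1), φ (.θE 2), φ (.θE 3), φ (.θE 0), φ (.AE 0),
      φ (.lam 1)]
    (by
      simp only [Fin.forall_fin_succ, Matrix.cons_val_zero, Matrix.cons_val_succ]
      exact ⟨hvan _ (hθ 1), hvan _ (hθ 2), hvan _ (hθ 0), hvan _ (hθE 1), hvan _ (hθE 2),
        hvan _ (hθE 3), hvan _ (hθE 0), hvan _ h41.ne', hvan _ hu, fun k => k.elim0⟩)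
  simp only [Fin.forall_fin_succ, Matrix.cons_val_zero, Matrix.cons_val_succ] at hpg
  obtain ⟨t1, t2, t0, t12, t23, t30, t01, b01, u, -⟩ := hpg
  have hq := h.quasismooth
  rw [pullbackIdeal_eq_span] at hq
  refine hp (hq.eq_zero_of_finrank_lt _ ?_
    (grad_relations_mem_span hb hA hA3 t1 t2 t0 t12 t23 t30 t01 b01 u))
  refine Nat.lt_succ_of_le ((finrank_span_insert_le _ _).trans (Nat.succ_le_succ ?_))
  exact finrank_span_four_le _ _ _ _

theorem eliminate_apply (φ : Var → MvPolynomial (Fin m) ℂ) {v : Var} (h1 : v ≠ .AE 1)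
    (h2 : v ≠ .θE 1) : eliminate φ v = φ v := by
  rw [eliminate, if_neg h1, if_neg h2]

theorem rel1_eliminate (φ : Var → MvPolynomial (Fin m) ℂ) : rel1 (eliminate φ) 1 2 3 0 = 0 := by
  obtain ⟨⟨e1, -, e3, -, e5, -, e7, -⟩, -⟩ := edge_par_values
  have hA : eliminate φ (.AE 1) = 1 := by simp [eliminate]
  have hE : eliminate φ (.θE 1) = φ (.θ 1) * φ (.θ 2) -
    φ (.AE 2) * φ (.A 3) * φ (.AE 3) ^ 2 * φ (.A 0) * φ (.AE 0) := by
    simp [eliminate, show (4 : ZMod 4) = 0 from rfl]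
  simp only [rel1, e1, e3, e5, e7, hA, hE]
  rw [eliminate_apply φ (v := .θ 1) (by simp) (by simp),
    eliminate_apply φ (v := .θ 2) (by simp) (by simp),
    eliminate_apply φ (v := .A 3) (by simp) (by simp),
    eliminate_apply φ (v := .A 0) (by simp) (by simp),
    eliminate_apply φ (v := .AE 0) (by decide) (by decide),
    eliminate_apply φ (v := .AE 2) (by decide) (by decide),
    eliminate_apply φ (v := .AE 3) (by decide) (by decide)]
  ring

/-- The same contradiction with eight functions on 𝔸⁹ and rank at most 4. -/
theorem deg_lam_one_eq_zero_of_isG25Cone {ρ ρE : ZMod 4 → ℤ} {a : Fin 9 → ℤ}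
    {φ : Var → MvPolynomial (Fin 9) ℂ} (h : IsG25Cone ρ ρE a φ)
    (h41 : 0 < deg ρ ρE (.AE 0)) (h3 : deg ρ ρE (.A 3) < 0) : deg ρ ρE (.lam 1) = 0 := by
  by_contra hu
  set x := eliminate φ with hx
  have hadm (v : Var) (h1 : v ≠ .AE 1) (h2 : v ≠ .θE 1) : IsAdmissibleAt ρ ρE a x v := by
    have := h.admissible v h1 h2
    rwa [IsAdmissibleAt, ← eliminate_apply φ h1 h2] at this
  have hvan (v : Var) (h1 : v ≠ .AE 1) (h2 : v ≠ .θE 1) (hv : deg ρ ρE v ≠ 0) :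
      eval 0 (x v) = 0 :=
    eval_zero_of_isWeightedHomogeneous hv (hadm v h1 h2).1
  have hA : x (.AE 1) = C 1 := by simp [hx, eliminate]
  have h12 : rel1 x 1 2 3 0 = 0 := rel1_eliminate φ
  have hnot : ¬ (IsUnit (x (.θ 1)) ∨ IsUnit (x (.θ 2)) ∨ IsUnit (x (.θ 0)) ∨
      IsUnit (x (.θE 2)) ∨ IsUnit (x (.θE 3)) ∨ IsUnit (x (.θE 0))) := fun hun => by
    obtain ⟨g, hg⟩ := exists_five_generators_of_isUnit x
      (by rw [hA]; exact isUnit_C_of_ne_zero one_ne_zero) h12 hun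
    exact h.not_ci ⟨5, g, by rw [pullbackIdeal_eq_span, hg], h.codim⟩
  have hdeg (v : Var) (h1 : v ≠ .AE 1) (h2 : v ≠ .θE 1) (hv : ¬ IsUnit (x v)) :
      eval 0 (x v) = 0 := hvan v h1 h2 fun h0 => by
    obtain ⟨c, hc, hφ⟩ := (hadm v h1 h2).exists_eq_C h.weight_pos h0
    exact hv (hφ ▸ isUnit_C_of_ne_zero hc)
  push Not at hnot
  obtain ⟨n1, n2, n0, n23, n30, n01⟩ := hnot
  have hA3 : x (.A 3) = 0 :=
    eq_zero_of_isWeightedHomogeneous_neg h.weight_pos h3 (hadm _ (by simp) (by simp)).1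
  obtain ⟨p, hp, hpg⟩ := exists_ne_zero_common_zero (n := 8) (m := 9) (by norm_num)
    ![x (.θ 1), x (.θ 2), x (.θ 0), x (.θE 2), x (.θE 3), x (.θE 0), x (.AE 0), x (.lam 1)] (by
      simp only [Fin.forall_fin_succ, Matrix.cons_val_zero, Matrix.cons_val_succ]
      exact ⟨hdeg _ (by decide) (by decide) n1, hdeg _ (by decide) (by decide) n2,
        hdeg _ (by decide) (by decide) n0, hdeg _ (by decide) (by decide) n23,
        hdeg _ (by decide) (by decide) n30, hdeg _ (by decide) (by decide) n01,
        hvan _ (by decide) (by decide) h41.ne', hvan _ (by decide) (by decide) hu,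
        fun k => k.elim0⟩)
  simp only [Fin.forall_fin_succ, Matrix.cons_val_zero, Matrix.cons_val_succ] at hpg
  obtain ⟨t1, t2, t0, t23, t30, t01, b01, u, -⟩ := hpg
  -- Since A_12 = 1 and A_3 = 0, the eliminated variable is θ_12 = θ_1θ_2, which vanishes with θ_1.
  have t12 : eval p (x (.θE 1)) = 0 := by
    obtain ⟨⟨e1, -, e3, -, e5, -, e7, -⟩, -⟩ := edge_par_values
    have h0 := congrArg (eval p) h12
    simpa [rel1, e1, e3, e5, e7, hA, hA3, t1] using h0
  have hq := h.quasismooth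
  rw [pullbackIdeal_eq_span] at hq
  refine hp (hq.eq_zero_of_finrank_lt _ ?_
    (grad_relations_mem_span one_ne_zero hA hA3 t1 t2 t0 t12 t23 t30 t01 b01 u))
  -- The first of the five spanning differentials belongs to the relation that is now identically
  -- zero, leaving four.
  rw [h12, map_zero, Submodule.span_insert_zero]
  exact Nat.lt_succ_of_le (finrank_span_four_le _ _ _ _)

/-! ### Reflection symmetry and the conclusion. -/

theorem deg_comp_reflect (ρ ρE : ZMod 4 → ℤ) (v : Var) :
    deg (fun i => ρ (3 - i)) (fun i => ρE (2 - i)) v = deg ρ ρE v.reflect := by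
  have h1 : ∀ i : ZMod 4, 2 - (i - 1) = 3 - i ∧ 3 - i - 1 = 2 - i ∧ 3 - (i + 1) = 2 - i ∧
    2 - i + 1 = 3 - i := by decide
  cases v with
  | θ i => rfl
  | θE i => rfl
  | A i =>
    simp only [deg, Var.reflect, Var.map, h1]
    ring
  | AE i =>
    simp only [deg, Var.reflect, Var.map, h1]
    ring
  | lam p =>
    have h2 : ∀ (p : ZMod 2) (i : ZMod 4), par (3 - i) = p ↔ par i = p + 1 := by decide
    simp only [deg, Var.reflect, Var.map, Finset.sum_sub_distrib]
    congr 1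
    · exact (Equiv.subLeft (2 : ZMod 4)).sum_comp ρE
    -- Reindexing by i ↦ 3 - i flips the parity of vertices, which exchanges the two diagonals.
    · rw [← (Equiv.subLeft (3 : ZMod 4)).sum_comp]
      simp only [Equiv.subLeft_apply, h2]
      simp

theorem pullbackIdeal_comp_reflect (φ : Var → MvPolynomial (Fin m) ℂ) :
    pullbackIdeal (φ ∘ Var.reflect) = pullbackIdeal φ := by
  rw [pullbackIdeal_eq_span, pullbackIdeal_eq_span, relations_comp_reflect]

theorem IsAdmissibleAt.reflect {ρ ρE : ZMod 4 → ℤ} {a : Fin m → ℤ}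
    {φ : Var → MvPolynomial (Fin m) ℂ} {v : Var} (h : IsAdmissibleAt ρ ρE a φ v.reflect) :
    IsAdmissibleAt (fun i => ρ (3 - i)) (fun i => ρE (2 - i)) a (φ ∘ Var.reflect) v := by
  rwa [IsAdmissibleAt, deg_comp_reflect]

theorem IsG2Cone.reflect {ρ ρE : ZMod 4 → ℤ} {a : Fin 10 → ℤ}
    {φ : Var → MvPolynomial (Fin 10) ℂ} (h : IsG2Cone ρ ρE a φ) :
    IsG2Cone (fun i => ρ (3 - i)) (fun i => ρE (2 - i)) a (φ ∘ Var.reflect) where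
  weight_pos := h.weight_pos
  admissible v := (h.admissible _).reflect
  codim := by rw [pullbackIdeal_comp_reflect]; exact h.codim
  quasismooth := by rw [pullbackIdeal_comp_reflect]; exact h.quasismooth
  not_ci := by rw [pullbackIdeal_comp_reflect]; exact h.not_ci

theorem Var.reflect_eq_iff (v w : Var) : v.reflect = w ↔ v = w.reflect :=
  ⟨fun h => by rw [← h, Var.reflect_reflect], fun h => by rw [h, Var.reflect_reflect]⟩

/-- The edge 12 is fixed by the reflection, and the formula for θ_12 is symmetric under θ_1 ↔ θ_2,
A_23 ↔ A_41, A_3 ↔ A_4. -/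
theorem eliminate_comp_reflect (φ : Var → MvPolynomial (Fin m) ℂ) :
    eliminate (φ ∘ Var.reflect) = eliminate φ ∘ Var.reflect := by
  have h1 : Var.reflect (.AE 1) = .AE 1 := by decide
  have h2 : Var.reflect (.θE 1) = .θE 1 := by decide
  funext v
  simp only [eliminate, Function.comp_apply, Var.reflect_eq_iff, h1, h2]
  split_ifs
  · rfl
  · rw [show Var.reflect (.θ 1) = .θ 2 by decide, show Var.reflect (.θ 2) = .θ 1 by decide,
      show Var.reflect (.AE 2) = .AE 4 by decide, show Var.reflect (.AE 3) = .AE 3 by decide,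
      show Var.reflect (.AE 4) = .AE 2 by decide, show Var.reflect (.A 3) = .A 4 by decide,
      show Var.reflect (.A 4) = .A 3 by decide]
    ring
  · rfl

theorem IsG25Cone.reflect {ρ ρE : ZMod 4 → ℤ} {a : Fin 9 → ℤ}
    {φ : Var → MvPolynomial (Fin 9) ℂ} (h : IsG25Cone ρ ρE a φ) :
    IsG25Cone (fun i => ρ (3 - i)) (fun i => ρE (2 - i)) a (φ ∘ Var.reflect) where
  weight_pos := h.weight_pos
  admissible v h1 h2 := (h.admissible _
    (fun h => h1 (by rw [(Var.reflect_eq_iff _ _).1 h]; decide))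
    (fun h => h2 (by rw [(Var.reflect_eq_iff _ _).1 h]; decide))).reflect
  codim := by rw [eliminate_comp_reflect, pullbackIdeal_comp_reflect]; exact h.codim
  quasismooth := by rw [eliminate_comp_reflect, pullbackIdeal_comp_reflect]; exact h.quasismooth
  not_ci := by rw [eliminate_comp_reflect, pullbackIdeal_comp_reflect]; exact h.not_ci

theorem deg_lam_one_eq_zero {ρ ρE : ZMod 4 → ℤ}
    (hY : (∃ a φ, IsG2Cone ρ ρE a φ) ∨ (∃ a φ, IsG25Cone ρ ρE a φ))
    (h12 : deg ρ ρE (.AE 1) = 0) (h41 : 0 < deg ρ ρE (.AE 0)) (h3 : deg ρ ρE (.A 3) < 0) :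
    deg ρ ρE (.lam 1) = 0 := by
  rcases hY with ⟨a, φ, h⟩ | ⟨a, φ, h⟩
  · exact deg_lam_one_eq_zero_of_isG2Cone h h12 h41 h3
  · exact deg_lam_one_eq_zero_of_isG25Cone h h41 h3

/-- Mirror image of `deg_lam_one_eq_zero`: the reflection turns the condition on A_41 into one on
A_23. -/
theorem deg_lam_zero_eq_zero {ρ ρE : ZMod 4 → ℤ}
    (hY : (∃ a φ, IsG2Cone ρ ρE a φ) ∨ (∃ a φ, IsG25Cone ρ ρE a φ))
    (h12 : deg ρ ρE (.AE 1) = 0) (h23 : 0 < deg ρ ρE (.AE 2)) (h4 : deg ρ ρE (.A 0) < 0) :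
    deg ρ ρE (.lam 0) = 0 := by
  have h := deg_lam_one_eq_zero (ρ := fun i => ρ (3 - i)) (ρE := fun i => ρE (2 - i))
    (hY.imp (fun ⟨a, φ, h⟩ => ⟨a, _, h.reflect⟩) fun ⟨a, φ, h⟩ => ⟨a, _, h.reflect⟩)
  simp only [deg_comp_reflect, show Var.reflect (.AE 1) = .AE 1 by decide,
    show Var.reflect (.AE 0) = .AE 2 by decide, show Var.reflect (.A 3) = .A 0 by decide,
    show Var.reflect (.lam 1) = .lam 0 by decide] at h
  exact h h12 h23 h4

end Main

end G2Format

theorem mainTheorem10 (ρ ρE : ZMod 4 → ℤ)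
    (hY : (∃ a φ, G2Format.IsG2Cone ρ ρE a φ) ∨ (∃ a φ, G2Format.IsG25Cone ρ ρE a φ))
    (h12 : G2Format.deg ρ ρE (.AE 1) = 0)
    (h23 : 0 < G2Format.deg ρ ρE (.AE 2))
    (h34 : 0 < G2Format.deg ρ ρE (.AE 3))
    (h41 : 0 < G2Format.deg ρ ρE (.AE 4)) :
    (0 ≤ G2Format.deg ρ ρE (.A 3) ∧ 0 ≤ G2Format.deg ρ ρE (.A 4)) ∨
    (G2Format.deg ρ ρE (.A 3) < 0 ∧ 0 ≤ G2Format.deg ρ ρE (.A 4) ∧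
      G2Format.deg ρ ρE (.lam 1) = 0) ∨
    (0 ≤ G2Format.deg ρ ρE (.A 3) ∧ G2Format.deg ρ ρE (.A 4) < 0 ∧
      G2Format.deg ρ ρE (.lam 0) = 0) ∨
    (G2Format.deg ρ ρE (.A 3) < 0 ∧ G2Format.deg ρ ρE (.A 4) < 0 ∧
      G2Format.deg ρ ρE (.lam 1) = 0 ∧ G2Format.deg ρ ρE (.lam 0) = 0) := by
  have h1 := fun h3 => G2Format.deg_lam_one_eq_zero hY h12 h41 h3
  have h0 := fun h4 => G2Format.deg_lam_zero_eq_zero hY h12 h23 h4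
  rcases lt_or_ge (G2Format.deg ρ ρE (.A 3)) 0 with h3 | h3 <;>
    rcases lt_or_ge (G2Format.deg ρ ρE (.A 4)) 0 with h4 | h4
  · exact Or.inr (Or.inr (Or.inr ⟨h3, h4, h1 h3, h0 h4⟩))
  · exact Or.inr (Or.inl ⟨h3, h4, h1 h3⟩)
  · exact Or.inr (Or.inr (Or.inl ⟨h3, h4, h0 h4⟩))
  · exact Or.inl ⟨h3, h4⟩
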